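/- Let $\mathbb R_n$ be the real Clifford algebra over the units $e_1,\dots,e_n$ ($e_i^2=-1$, $e_ie_j=-e_je_i$ for $i\ne j$) with the Euclidean norm $|y|^2=\sum_A y_A^2$ for $y=\sum_A y_Ae_A$. For $x=(x_0,x_1,\dots,x_n)\in\mathbb R^{n+1}$ write $\underline x=(x_1,\dots,x_n)$ and $z_i=x_i-x_0e_i$. A $C^1$ function $f:\mathbb R^{n+1}\to\mathbb R_n$ is (entire left) monogenic if $\partial_{x_0}f+\sum_{i=1}^n e_i\partial_{x_i}f=0$. The CK-extension of a function $f:\mathbb R^n\to\mathbb R_n$ given by an everywhere convergent power series is $$f^*(x)=\sum_{k=0}^\infty(-1)^k\Big(\partial_{x_0}-\sum_{i=1}^n e_i\partial_{x_i}\Big)\Big[\frac{x_0^{2k+1}}{(2k+1)!}\Delta_n^kf(\underline x)\Big],$$ and the CK-product of entire monogenic functions is $f\odot_L g=\big(f|_{x_0=0}\cdot g|_{x_0=0}\big)^*$; $f^{\odot_L k}$ denotes the corresponding power, with $f^{\odot_L 0}=1$. With $\zeta(x)=z_1e_1+\dots+z_ne_n$ put $$E(x)=\sum_{k\ge0}\frac{\zeta^{\odot_L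 k}(x)}{k!},\quad \operatorname{Cosh}(x)=\sum_{k\ge0}\frac{\zeta^{\odot_L 2k}(x)}{(2k)!},\quad \operatorname{Sinh}(x)=\sum_{k\ge0}\frac{\zeta^{\odot_L(2k+1)}(x)}{(2k+1)!}.$$ For $a\in\mathbb R$ and integers $N\ge1$ let $$F_N(x,a)=\big(\operatorname{Cosh}(x/N)+a\operatorname{Sinh}(x/N)\big)^{\odot_L N},\qquad C_j(N,a)=\binom Nj\Big(\frac{1+a}2\Big)^{N-j}\Big(\frac{1-a}2\Big)^j,$$ and let $\alpha=\max(1,|a|)$. Lemma. For every $a\in\mathbb R$: (i) $F_N(x,a)=\sum_{j=0}^N C_j(N,a)\,E\big((1-2j/N)x\big)$ for all $N\ge1$ and $x\in\mathbb R^{n+1}$; (ii) $|F_N(x,a)|\le\exp\big((\alpha+1)\,n\,|x|\big)$ for all $N\ge1$ and $x\in\mathbb R^{n+1}$; (iii) $F_N(\cdot,a)\to E(a\,\cdot)$ in the monogenic space $A_1$ as $N\to\infty$: there is $\sigma>0$ such that $E(a\,\cdot)$ and all $F_N(\cdot,a)$, $N\ge1$, belong to $A_{1,\sigma}$, the space of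 entire left monogenic functions $f$ with $\|f\|_{1,\sigma}:=\sup_{x\in\mathbb R^{n+1}}|f(x)|e^{-\sigma|x|}<\infty$, and $\|F_N(\cdot,a)-E(a\,\cdot)\|_{1,\sigma}\to0$. -/

import Mathlib

/-- The negative definite quadratic form `v ↦ -(v₁² + ⋯ + vₙ²)` on `ℝⁿ`. -/
noncomputable def cliffordForm (n : ℕ) : QuadraticForm ℝ (Fin n → ℝ) :=
  QuadraticMap.weightedSumSquares ℝ (fun _ : Fin n => (-1 : ℝ))

theorem cliffordForm_apply {n : ℕ} (v : Fin n → ℝ) : cliffordForm n v = -∑ i, v i ^ 2 := by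
  unfold cliffordForm
  simp [QuadraticMap.weightedSumSquares_apply, pow_two]

/-- The real Clifford algebra `ℝ_n` over `n` imaginary units. -/
abbrev RealClifford (n : ℕ) : Type := CliffordAlgebra (cliffordForm n)

namespace RealClifford

/-- The imaginary units `e_1, …, e_n` (indexed by `Fin n`). -/
noncomputable def e {n : ℕ} (i : Fin n) : RealClifford n :=
  CliffordAlgebra.ι (cliffordForm n) (Pi.single i 1)

/-- `e_A = e_{i_1} ⋯ e_{i_r}` for `A = {i_1 < ⋯ < i_r}`, with `e_∅ = 1`. -/
noncomputable def blade {n : ℕ} (A : Finset (Fin n)) : RealClifford n :=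
  (A.sort.map e).prod

theorem e_mul_self {n : ℕ} (i : Fin n) : (e i : RealClifford n) * e i = -1 := by
  rw [e, CliffordAlgebra.ι_sq_scalar, cliffordForm_apply]
  simp [Pi.single_apply]

theorem isOrtho_single {n : ℕ} {i j : Fin n} (h : i ≠ j) :
    (cliffordForm n).IsOrtho (Pi.single i 1) (Pi.single j 1) := by
  rw [QuadraticMap.isOrtho_def]
  simp only [cliffordForm_apply, Pi.add_apply, ← neg_add, ← Finset.sum_add_distrib]
  congr 1
  refine Finset.sum_congr rfl fun k _ => ?_
  by_cases hi : k = i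
  · have : k ≠ j := fun hh => h (hi ▸ hh)
    simp [hi, h]
  · simp [hi]

theorem e_mul_e_of_ne {n : ℕ} {i j : Fin n} (h : i ≠ j) :
    (e i : RealClifford n) * e j = -(e j * e i) :=
  CliffordAlgebra.ι_mul_ι_comm_of_isOrtho (isOrtho_single h)

theorem contractLeft_prod_eq_zero {n : ℕ} (d : Module.Dual ℝ (Fin n → ℝ)) (l : List (Fin n))
    (h : ∀ j ∈ l, d (Pi.single j 1) = 0) :
    CliffordAlgebra.contractLeft d ((l.map fun j =>
      CliffordAlgebra.ι (0 : QuadraticForm ℝ (Fin n → ℝ)) (Pi.single j 1)).prod) = 0 := by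
  induction l with
  | nil => simp [CliffordAlgebra.contractLeft_one]
  | cons j t ih =>
    rw [List.map_cons, List.prod_cons, CliffordAlgebra.contractLeft_ι_mul,
      ih (fun k hk => h k (List.mem_cons_of_mem _ hk)), h j List.mem_cons_self]
    simp

theorem equivExterior_prod {n : ℕ} (l : List (Fin n)) (h : l.Nodup) :
    CliffordAlgebra.equivExterior (cliffordForm n) ((l.map e).prod) =
      ((l.map fun j => ExteriorAlgebra.ι ℝ (Pi.single j (1 : ℝ) : Fin n → ℝ)).prod) := by
  induction l with
  | nil => exact CliffordAlgebra.changeForm_one CliffordAlgebra.changeForm.associated_neg_proof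
  | cons i t ih =>
    rw [List.nodup_cons] at h
    have ih' := ih h.2
    change CliffordAlgebra.changeForm CliffordAlgebra.changeForm.associated_neg_proof _ = _ at ih'
    change CliffordAlgebra.changeForm CliffordAlgebra.changeForm.associated_neg_proof _ = _
    rw [List.map_cons, List.prod_cons, e, CliffordAlgebra.changeForm_ι_mul, ih']
    erw [contractLeft_prod_eq_zero]
    · rw [sub_zero]; rfl
    · intro j hj
      have hij : i ≠ j := fun hh => h.1 (hh ▸ hj)
      have ho := QuadraticMap.isOrtho_def.1 (isOrtho_single hij)
      rw [QuadraticMap.associated_apply]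
      simp only [neg_apply, ho]
      simp

theorem equivExterior_blade {n : ℕ} (A : Finset (Fin n)) :
    CliffordAlgebra.equivExterior (cliffordForm n) (blade A) =
      (Pi.basisFun ℝ (Fin n)).ExteriorAlgebra A := by
  rw [blade, equivExterior_prod _ (Finset.sort_nodup _ _), ExteriorAlgebra.basis_apply_ofCard _ rfl]
  unfold ExteriorAlgebra.ιMulti_family
  rw [ExteriorAlgebra.ιMulti_apply,
    ← Finset.listMap_orderEmbOfFin_finRange A rfl, List.map_map, List.ofFn_eq_map]
  simp only [Pi.basisFun_apply, Function.comp_def]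
  rfl

/-- The elements `e_A`, `A ⊆ {1, …, n}`, form a basis of `ℝ_n`. -/
noncomputable def bladeBasis (n : ℕ) : Module.Basis (Finset (Fin n)) ℝ (RealClifford n) :=
  Module.Basis.mk (v := blade)
    (by
      have h : (fun A => CliffordAlgebra.equivExterior (cliffordForm n) (blade A)) =
          (Pi.basisFun ℝ (Fin n)).ExteriorAlgebra := funext equivExterior_blade
      refine LinearIndependent.of_comp
        (CliffordAlgebra.equivExterior (cliffordForm n)).toLinearMap ?_
      change LinearIndependent ℝ
        (fun A => CliffordAlgebra.equivExterior (cliffordForm n) (blade A))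
      rw [h]
      exact (Pi.basisFun ℝ (Fin n)).ExteriorAlgebra.linearIndependent)
    (by
      intro y _
      have hy := (Pi.basisFun ℝ (Fin n)).ExteriorAlgebra.mem_span
        (CliffordAlgebra.equivExterior (cliffordForm n) y)
      have h : (Set.range (Pi.basisFun ℝ (Fin n)).ExteriorAlgebra) =
          (CliffordAlgebra.equivExterior (cliffordForm n)).toLinearMap '' Set.range blade := by
        rw [← Set.range_comp]
        exact congrArg Set.range (funext fun A => (equivExterior_blade A).symm)
      rw [h, Submodule.span_image] at hy
      obtain ⟨z, hz, hzy⟩ := hy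
      rwa [← (CliffordAlgebra.equivExterior (cliffordForm n)).injective hzy])

theorem bladeBasis_apply {n : ℕ} (A : Finset (Fin n)) : bladeBasis n A = blade A := by
  simp [bladeBasis]

/-- The coordinates `(y_A)_A` of a Clifford number `y = ∑_A y_A e_A`. -/
noncomputable def coords (n : ℕ) : RealClifford n →ₗ[ℝ] EuclideanSpace ℝ (Finset (Fin n)) :=
  ((bladeBasis n).equivFun.trans (WithLp.linearEquiv 2 ℝ (Finset (Fin n) → ℝ)).symm).toLinearMap

theorem coords_injective (n : ℕ) : Function.Injective (coords n) :=
  ((bladeBasis n).equivFun.trans (WithLp.linearEquiv 2 ℝ (Finset (Fin n) → ℝ)).symm).injective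

/-- The Euclidean norm `|y|² = ∑_A y_A²` on `ℝ_n`; see `norm_sq_eq`. -/
noncomputable instance instNormedAddCommGroup (n : ℕ) : NormedAddCommGroup (RealClifford n) :=
  NormedAddCommGroup.induced (RealClifford n) (EuclideanSpace ℝ (Finset (Fin n))) (coords n)
    (coords_injective n)

noncomputable instance instNormedSpace (n : ℕ) : NormedSpace ℝ (RealClifford n) :=
  NormedSpace.induced ℝ (RealClifford n) (EuclideanSpace ℝ (Finset (Fin n))) (coords n)

theorem norm_sq_eq {n : ℕ} (y : RealClifford n) :
    ‖y‖ ^ 2 = ∑ A, (bladeBasis n).repr y A ^ 2 := by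
  change ‖coords n y‖ ^ 2 = _
  rw [EuclideanSpace.norm_sq_eq]
  simp [coords]

end RealClifford

namespace Monogenic

open RealClifford

/-- `ℝ^{n+1}` with the Euclidean norm; a point is `(x_0, x_1, …, x_n)`, where `x_0` is `x 0` and
the coordinate belonging to the unit `e i` is `x i.succ`. -/
abbrev Paravector (n : ℕ) : Type := EuclideanSpace ℝ (Fin (n + 1))

/-- The partial derivative of `f` with respect to the `i`-th coordinate of `ℝ^{n+1}`. -/
noncomputable def partialDeriv {n : ℕ} (i : Fin (n + 1)) (f : Paravector n → RealClifford n)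
    (x : Paravector n) : RealClifford n :=
  fderiv ℝ f x (EuclideanSpace.single i 1)

/-- The generalized Cauchy-Riemann operator `D = ∂_{x_0} + ∑_i e_i ∂_{x_i}`. -/
noncomputable def cauchyRiemann {n : ℕ} (f : Paravector n → RealClifford n)
    (x : Paravector n) : RealClifford n :=
  partialDeriv 0 f x + ∑ i : Fin n, e i * partialDeriv i.succ f x

/-- The conjugate operator `∂_{x_0} - ∑_i e_i ∂_{x_i}`. -/
noncomputable def conjCauchyRiemann {n : ℕ} (f : Paravector n → RealClifford n)
    (x : Paravector n) : RealClifford n :=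
  partialDeriv 0 f x - ∑ i : Fin n, e i * partialDeriv i.succ f x

/-- Entire left monogenic functions. -/
def IsLeftMonogenic {n : ℕ} (f : Paravector n → RealClifford n) : Prop :=
  ContDiff ℝ 1 f ∧ ∀ x, cauchyRiemann f x = 0

/-- The projection `(x_0, x_1, …, x_n) ↦ (x_1, …, x_n)`. -/
noncomputable def vecPart {n : ℕ} (x : Paravector n) : EuclideanSpace ℝ (Fin n) :=
  WithLp.toLp 2 fun i => x i.succ

/-- The inclusion `(x_1, …, x_n) ↦ (0, x_1, …, x_n)`. -/
noncomputable def ofVec {n : ℕ} (v : EuclideanSpace ℝ (Fin n)) : Paravector n :=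
  WithLp.toLp 2 (Fin.cons 0 fun i => v i)

/-- The Cauchy-Kowalewski extension
`f^*(x) = ∑_k (-1)^k (∂_{x_0} - ∑_i e_i ∂_{x_i}) [x_0^{2k+1} / (2k+1)! Δ_n^k f(x_1, …, x_n)]`,
with `Δ_n` the Laplacian of `ℝⁿ`. -/
noncomputable def ckExtension {n : ℕ} (f : EuclideanSpace ℝ (Fin n) → RealClifford n)
    (x : Paravector n) : RealClifford n :=
  ∑' k : ℕ, (-1 : ℝ) ^ k • conjCauchyRiemann
    (fun y => (y 0 ^ (2 * k + 1) / ((2 * k + 1).factorial : ℝ)) •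
      (Laplacian.laplacian^[k] f) (vecPart y)) x

/-- The CK-product `f ⊙_L g`: the CK-extension of the pointwise product of the restrictions of
`f` and `g` to `x_0 = 0`. -/
noncomputable def ckProd {n : ℕ} (f g : Paravector n → RealClifford n) :
    Paravector n → RealClifford n :=
  ckExtension fun v => f (ofVec v) * g (ofVec v)

/-- The power `f^{⊙_L k}` with respect to the CK-product. -/
noncomputable def ckPow {n : ℕ} (f : Paravector n → RealClifford n) :
    ℕ → Paravector n → RealClifford n
  | 0 => fun _ => 1
  | k + 1 => ckProd (ckPow f k) f

/-- The Fueter variable `z_i = x_i - x_0 e_i`. -/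
noncomputable def fueterVar {n : ℕ} (i : Fin n) (x : Paravector n) : RealClifford n :=
  algebraMap ℝ (RealClifford n) (x i.succ) - x 0 • e i

/-- The function `z_1 e_1 + ⋯ + z_n e_n`, the CK-extension of `x_1 e_1 + ⋯ + x_n e_n`. -/
noncomputable def zetaVar {n : ℕ} (x : Paravector n) : RealClifford n :=
  ∑ i : Fin n, fueterVar i x * e i

/-- The monogenic exponential `E(x) = ∑_k (z_1 e_1 + ⋯ + z_n e_n)^{⊙_L k} / k!`. -/
noncomputable def expE {n : ℕ} (x : Paravector n) : RealClifford n :=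
  ∑' k : ℕ, ((k.factorial : ℝ)⁻¹) • ckPow zetaVar k x

/-- `Cosh(x) = ∑_k (z_1 e_1 + ⋯ + z_n e_n)^{⊙_L 2k} / (2k)!`. -/
noncomputable def coshE {n : ℕ} (x : Paravector n) : RealClifford n :=
  ∑' k : ℕ, (((2 * k).factorial : ℝ)⁻¹) • ckPow zetaVar (2 * k) x

/-- `Sinh(x) = ∑_k (z_1 e_1 + ⋯ + z_n e_n)^{⊙_L 2k+1} / (2k+1)!`. -/
noncomputable def sinhE {n : ℕ} (x : Paravector n) : RealClifford n :=
  ∑' k : ℕ, (((2 * k + 1).factorial : ℝ)⁻¹) • ckPow zetaVar (2 * k + 1) x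

/-- `F_N(x, a) = (Cosh(x / N) + a Sinh(x / N))^{⊙_L N}`, meant for `N ≥ 1`. -/
noncomputable def prototypeF {n : ℕ} (N : ℕ) (a : ℝ) : Paravector n → RealClifford n :=
  ckPow (fun x => coshE ((N : ℝ)⁻¹ • x) + a • sinhE ((N : ℝ)⁻¹ • x)) N

/-- `C_j(N, a) = binom(N, j) ((1 + a) / 2)^{N - j} ((1 - a) / 2)^j`, for `j ≤ N`. -/
noncomputable def coeffC (j N : ℕ) (a : ℝ) : ℝ :=
  (N.choose j : ℝ) * ((1 + a) / 2) ^ (N - j) * ((1 - a) / 2) ^ j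

/-- `‖f‖_{1,σ} = sup_x |f(x)| e^{-σ|x|}`; meaningful when this set of values is bounded, as it is
for members of `A_{1,σ}`. -/
noncomputable def expNorm {n : ℕ} (σ : ℝ) (f : Paravector n → RealClifford n) : ℝ :=
  ⨆ x, ‖f x‖ * Real.exp (-σ * ‖x‖)

/-- `f ∈ A_{1,σ}(ℝ^{n+1})`: `f` is entire left monogenic with `‖f‖_{1,σ} < ∞`. -/
def MemA {n : ℕ} (σ : ℝ) (f : Paravector n → RealClifford n) : Prop :=
  IsLeftMonogenic f ∧ BddAbove (Set.range fun x => ‖f x‖ * Real.exp (-σ * ‖x‖))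

/-- Convergence of a sequence `f_N` to `f` in the space `A_1` of entire left monogenic functions of
exponential growth. -/
def ConvergesInA {n : ℕ} (F : ℕ → Paravector n → RealClifford n)
    (f : Paravector n → RealClifford n) : Prop :=
  ∃ σ : ℝ, 0 < σ ∧ MemA σ f ∧ (∀ N, MemA σ (F N)) ∧
    Filter.Tendsto (fun N => expNorm σ (F N - f)) Filter.atTop (nhds 0)

end Monogenic

/-! Every function in the statement is encoded by a real power series `b` in one variable: it is the
CK-extension `ckSeries b` of the function v ↦ ∑ b_k v^k (`vecSeries b`) on ℝⁿ ⊆ ℝ_n. Powers of a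
single vector multiply by adding exponents, so the CK-product becomes multiplication of power series
(`ExpBound.ckProd_ckSeries`). Since z_1e_1 + ⋯ + z_ne_n extends v, the function E(cx) is encoded by
exp(ct), and Cosh(x/N) + a Sinh(x/N) by q = (1+a)/2 · exp(t/N) + (1-a)/2 · exp(-t/N). Part (i) is
then the binomial theorem for q^N.

The extension is computed from ∂v^k = -c_k v^{k-1}, where ∂ = ∑ e_i ∂_{x_i}, c_k = k for even k and
c_k = k + n - 1 for odd k. As Δ = -∂², the defining series is exp(-x_0 ∂) applied to f, so v^k
extends to the polynomial P_k = ∑_{m+j=k} (c_{m+1} ⋯ c_k / j!) x_0^j v^m (`ckPoly`).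

The analytic core is |P_k(x)| ≤ (n|x|)^k (`norm_ckPoly_le`). The vector v acts like the imaginary
number i|v|, which turns P_k into a complex number Q_k satisfying (k+1) Q_{k+1} + (n-1) i Im Q_{k+1}
= c_{k+1} (x_0 + i|v|) Q_k. The left side has modulus at least (k+1)|Q_{k+1}|, and c_{k+1} ≤ n(k+1).
Hence a series whose coefficients are majorized by those of M exp(ρt) (`ExpBound`) has an extension
bounded by M exp(ρn|x|), and all estimates become statements about coefficients.

For (ii), q is majorized by exp(αt/N), hence q^N by exp(αt). For (iii), q and p = exp(at/N) agree up
to degree 1, so q - p is majorized by (2/N²) exp(αt). Factoring q - p out of q^N - p^N then gives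
the majorant (2/N) exp(2αt). -/

namespace RealClifford

/-! ### Continuity of the product, and norms of powers of a vector -/

instance instFiniteDimensional (n : ℕ) : FiniteDimensional ℝ (RealClifford n) :=
  Module.Finite.of_basis (bladeBasis n)

/-- Multiplication of `ℝ_n` as a continuous bilinear map. -/
noncomputable def mulCLM (n : ℕ) : RealClifford n →L[ℝ] RealClifford n →L[ℝ] RealClifford n :=
  (LinearMap.mul ℝ (RealClifford n)).toContinuousBilinearMap

@[simp] theorem mulCLM_apply {n : ℕ} (a b : RealClifford n) : mulCLM n a b = a * b := rfl

instance instContinuousMul (n : ℕ) : ContinuousMul (RealClifford n) where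
  continuous_mul := (mulCLM n).continuous₂

instance instIsTopologicalRing (n : ℕ) : IsTopologicalRing (RealClifford n) where

/-- The embedding `(v_1, …, v_n) ↦ ∑ v_i e_i` of `ℝⁿ` into `ℝ_n`. -/
noncomputable def vec (n : ℕ) : EuclideanSpace ℝ (Fin n) →L[ℝ] RealClifford n :=
  LinearMap.toContinuousLinearMap
    ((CliffordAlgebra.ι (cliffordForm n)).comp (WithLp.linearEquiv 2 ℝ (Fin n → ℝ)).toLinearMap)

theorem vec_apply {n : ℕ} (v : EuclideanSpace ℝ (Fin n)) :
    vec n v = CliffordAlgebra.ι (cliffordForm n) (WithLp.ofLp v) := rfl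

theorem vec_single {n : ℕ} (i : Fin n) : vec n (EuclideanSpace.single i 1) = e i := by
  rw [vec_apply, e]
  rfl

theorem vec_eq_sum {n : ℕ} (v : EuclideanSpace ℝ (Fin n)) : vec n v = ∑ i, v i • e i := by
  conv_lhs => rw [← (EuclideanSpace.basisFun (Fin n) ℝ).sum_repr v]
  simp [vec_single]

theorem vec_mul_self {n : ℕ} (v : EuclideanSpace ℝ (Fin n)) :
    vec n v * vec n v = algebraMap ℝ _ (-‖v‖ ^ 2) := by
  rw [vec_apply, CliffordAlgebra.ι_sq_scalar, cliffordForm_apply, EuclideanSpace.norm_sq_eq]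
  simp

theorem vec_pow_two_mul {n : ℕ} (v : EuclideanSpace ℝ (Fin n)) (m : ℕ) :
    vec n v ^ (2 * m) = (-‖v‖ ^ 2) ^ m • (1 : RealClifford n) := by
  rw [pow_mul, pow_two, vec_mul_self, ← map_pow, Algebra.algebraMap_eq_smul_one]

theorem vec_pow_two_mul_add_one {n : ℕ} (v : EuclideanSpace ℝ (Fin n)) (m : ℕ) :
    vec n v ^ (2 * m + 1) = (-‖v‖ ^ 2) ^ m • vec n v := by
  rw [pow_succ, vec_pow_two_mul, smul_mul_assoc, one_mul]

theorem blade_empty (n : ℕ) : blade (∅ : Finset (Fin n)) = 1 := by simp [blade]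

theorem blade_singleton {n : ℕ} (i : Fin n) : blade {i} = e i := by simp [blade]

/-- The blades 1, e_1, …, e_n are orthonormal. The Euclidean norm of ℝ_n is not submultiplicative in
general, so sharp estimates are made inside the span of 1 and one vector, which contains all powers
of that vector. -/
theorem norm_smul_one_add_smul_vec_sq {n : ℕ} (a b : ℝ) (v : EuclideanSpace ℝ (Fin n)) :
    ‖a • (1 : RealClifford n) + b • vec n v‖ ^ 2 = a ^ 2 + b ^ 2 * ‖v‖ ^ 2 := by
  classical
  have h : a • (1 : RealClifford n) + b • vec n v =
      a • bladeBasis n ∅ + ∑ i, (b * v i) • bladeBasis n {i} := by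
    simp_rw [bladeBasis_apply, blade_empty, blade_singleton, vec_eq_sum, Finset.smul_sum, mul_smul]
  have hrepr : ∀ A : Finset (Fin n), (bladeBasis n).repr (a • 1 + b • vec n v) A =
      (if A = ∅ then a else 0) + ∑ i, if A = {i} then b * v i else 0 := by
    intro A
    rw [h]
    simp only [map_add, map_smul, map_sum, Finsupp.add_apply, Finsupp.smul_apply,
      Finsupp.finsetSum_apply, Module.Basis.repr_self, Finsupp.single_apply, smul_eq_mul,
      mul_ite, mul_one, mul_zero, eq_comm (b := A)]
  -- For each `A` at most one of the summands in `hrepr` is nonzero, so squaring acts termwise.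
  have hsq : ∀ A : Finset (Fin n), ((bladeBasis n).repr (a • 1 + b • vec n v) A) ^ 2 =
      (if A = ∅ then a ^ 2 else 0) + ∑ i, if A = {i} then (b * v i) ^ 2 else 0 := by
    intro A
    rw [hrepr]
    by_cases hA : A = ∅
    · simp [hA]
    · by_cases hi : ∃ i, A = {i}
      · obtain ⟨i, rfl⟩ := hi
        simp [Finset.singleton_inj]
      · push Not at hi
        simp [hA, hi]
  rw [norm_sq_eq, Finset.sum_congr rfl fun A _ => hsq A, Finset.sum_add_distrib, Finset.sum_comm,
    EuclideanSpace.norm_sq_eq, Finset.mul_sum]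
  simp [mul_pow]

@[simp] theorem norm_one_eq (n : ℕ) : ‖(1 : RealClifford n)‖ = 1 := by
  have h := norm_smul_one_add_smul_vec_sq 1 0 (0 : EuclideanSpace ℝ (Fin n))
  rw [← sq_eq_sq₀ (norm_nonneg _) zero_le_one]
  simpa using h

@[simp] theorem norm_vec {n : ℕ} (v : EuclideanSpace ℝ (Fin n)) : ‖vec n v‖ = ‖v‖ := by
  have h := norm_smul_one_add_smul_vec_sq 0 1 v
  simpa using h

@[simp] theorem norm_vec_pow {n : ℕ} (v : EuclideanSpace ℝ (Fin n)) (k : ℕ) :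
    ‖vec n v ^ k‖ = ‖v‖ ^ k := by
  obtain ⟨m, rfl | rfl⟩ := k.even_or_odd'
  · rw [vec_pow_two_mul, norm_smul]
    simp [pow_mul]
  · rw [vec_pow_two_mul_add_one, norm_smul]
    simp [pow_mul, pow_succ]

/-! ### Derivatives of vector powers and the Dirac coefficients -/

/-- The coefficient `c_k` in `∂ v^k = -c_k v^{k-1}`, where `∂` is the Dirac operator of `ℝⁿ`. -/
noncomputable def diracCoeff (n k : ℕ) : ℝ := k + ((n : ℝ) - 1) * (1 - (-1) ^ k) / 2

theorem diracCoeff_two_mul (n m : ℕ) : diracCoeff n (2 * m) = 2 * m := by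
  simp [diracCoeff]

theorem diracCoeff_two_mul_add_one (n m : ℕ) : diracCoeff n (2 * m + 1) = 2 * m + n := by
  simp [diracCoeff, pow_succ]
  ring

@[simp] theorem diracCoeff_zero (n : ℕ) : diracCoeff n 0 = 0 := by simp [diracCoeff]

theorem diracCoeff_nonneg (n k : ℕ) : 0 ≤ diracCoeff n k := by
  obtain ⟨m, rfl | rfl⟩ := k.even_or_odd'
  · rw [diracCoeff_two_mul]; positivity
  · rw [diracCoeff_two_mul_add_one]; positivity

theorem diracCoeff_le (n k : ℕ) : diracCoeff n k ≤ (n + 1) * k := by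
  have hn : (0 : ℝ) ≤ n := n.cast_nonneg
  obtain ⟨m, rfl | rfl⟩ := k.even_or_odd'
  · rw [diracCoeff_two_mul]; push_cast
    have : (0 : ℝ) ≤ n * (2 * m) := by positivity
    linarith
  · rw [diracCoeff_two_mul_add_one]; push_cast
    have : (0 : ℝ) ≤ n * (2 * m) := by positivity
    linarith

/-- This sharper constant produces the growth rate n|x| of the final estimate. It fails for n = 0,
where c_2 = 2; the cruder factor n + 1 is enough wherever only convergence matters. -/
theorem diracCoeff_le_of_one_le {n : ℕ} (hn : 1 ≤ n) (k : ℕ) : diracCoeff n k ≤ n * k := by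
  have hn : (1 : ℝ) ≤ n := by exact_mod_cast hn
  have hm (m : ℕ) : (0 : ℝ) ≤ (n - 1) * (2 * m) := mul_nonneg (by linarith) (by positivity)
  obtain ⟨m, rfl | rfl⟩ := k.even_or_odd'
  · rw [diracCoeff_two_mul]; push_cast
    linarith [hm m]
  · rw [diracCoeff_two_mul_add_one]; push_cast
    linarith [hm m]

/-- The derivative of `v ↦ v^k`, `v ∈ ℝⁿ ⊆ ℝ_n`. -/
noncomputable def vecPowDeriv {n : ℕ} (k : ℕ) (v : EuclideanSpace ℝ (Fin n)) :
    EuclideanSpace ℝ (Fin n) →L[ℝ] RealClifford n :=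
  (-(2 * (k / 2 : ℕ) : ℝ)) • (innerSL ℝ v).smulRight (vec n v ^ (k - 2)) +
    if Even k then 0 else (mulCLM n (vec n v ^ (k - 1))).comp (vec n)

theorem vecPowDeriv_two_mul_apply {n : ℕ} (m : ℕ) (v h : EuclideanSpace ℝ (Fin n)) :
    vecPowDeriv (2 * m) v h = (-(2 * m) * inner ℝ v h : ℝ) • vec n v ^ (2 * m - 2) := by
  simp [vecPowDeriv, mul_smul]

theorem vecPowDeriv_two_mul_add_one_apply {n : ℕ} (m : ℕ) (v h : EuclideanSpace ℝ (Fin n)) :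
    vecPowDeriv (2 * m + 1) v h = (-(2 * m) * inner ℝ v h : ℝ) • vec n v ^ (2 * m - 1) +
      (-‖v‖ ^ 2) ^ m • vec n h := by
  have h1 : (2 * m + 1) / 2 = m := by omega
  have h2 : 2 * m + 1 - 2 = 2 * m - 1 := by omega
  rw [vecPowDeriv, if_neg (by simp), h1, h2]
  simp [mul_smul, vec_pow_two_mul]

theorem hasFDerivAt_neg_norm_sq_pow {n : ℕ} (m : ℕ) (v : EuclideanSpace ℝ (Fin n)) :
    HasFDerivAt (fun v : EuclideanSpace ℝ (Fin n) => (-‖v‖ ^ 2) ^ m)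
      ((-(2 * m) * (-‖v‖ ^ 2) ^ (m - 1) : ℝ) • innerSL ℝ v) v := by
  have h := ((hasStrictFDerivAt_norm_sq v).hasFDerivAt.neg).pow m
  refine h.congr_fderiv ?_
  ext w
  simp
  ring

/-- An even power is a power of the scalar -‖v‖², and an odd power is such a scalar times v. The
truncated exponents k - 2 are harmless, because k / 2 = 0 for k = 0, 1. -/
theorem hasFDerivAt_vec_pow {n : ℕ} (k : ℕ) (v : EuclideanSpace ℝ (Fin n)) :
    HasFDerivAt (fun v => vec n v ^ k) (vecPowDeriv k v) v := by
  obtain ⟨m, rfl | rfl⟩ := k.even_or_odd'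
  · simp_rw [vec_pow_two_mul]
    refine ((hasFDerivAt_neg_norm_sq_pow m v).smul_const _).congr_fderiv ?_
    ext w
    rw [vecPowDeriv_two_mul_apply, show 2 * m - 2 = 2 * (m - 1) by omega, vec_pow_two_mul]
    simp only [ContinuousLinearMap.smulRight_apply, smul_smul]
    congr 1
    simp
    ring
  · simp_rw [vec_pow_two_mul_add_one]
    refine ((hasFDerivAt_neg_norm_sq_pow m v).smul (vec n).hasFDerivAt).congr_fderiv ?_
    ext w
    rw [vecPowDeriv_two_mul_add_one_apply, add_comm]
    rcases m with _ | m
    · simp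
    · rw [show 2 * (m + 1) - 1 = 2 * m + 1 by omega, vec_pow_two_mul_add_one]
      simp [smul_smul]
      congr 1
      ring_nf

theorem norm_vecPowDeriv_le {n : ℕ} (k : ℕ) (v : EuclideanSpace ℝ (Fin n)) :
    ‖vecPowDeriv k v‖ ≤ k * ‖v‖ ^ (k - 1) := by
  refine ContinuousLinearMap.opNorm_le_bound _ (by positivity) fun h => ?_
  have hi := abs_real_inner_le_norm v h
  obtain ⟨m, rfl | rfl⟩ := k.even_or_odd'
  · rw [vecPowDeriv_two_mul_apply, norm_smul, norm_vec_pow]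
    rcases m with _ | m
    · simp
    rw [show 2 * (m + 1) - 2 = 2 * m by omega, show 2 * (m + 1) - 1 = 2 * m + 1 by omega,
      Real.norm_eq_abs, abs_mul, abs_neg, abs_of_nonneg (by positivity)]
    calc (2 * ((m + 1 : ℕ) : ℝ)) * |inner ℝ v h| * ‖v‖ ^ (2 * m)
        ≤ (2 * ((m + 1 : ℕ) : ℝ)) * (‖v‖ * ‖h‖) * ‖v‖ ^ (2 * m) := by gcongr
      _ = _ := by push_cast; ring
  · rw [vecPowDeriv_two_mul_add_one_apply]
    refine (norm_add_le _ _).trans ?_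
    rw [norm_smul, norm_smul, norm_vec_pow, norm_vec, Real.norm_eq_abs, abs_mul, abs_neg,
      abs_of_nonneg (by positivity : (0 : ℝ) ≤ 2 * m), norm_pow, norm_neg, norm_pow, norm_norm,
      ← pow_mul]
    rcases m with _ | m
    · simp
    rw [show 2 * (m + 1) - 1 = 2 * m + 1 by omega, Nat.add_sub_cancel]
    calc (2 * ((m + 1 : ℕ) : ℝ)) * |inner ℝ v h| * ‖v‖ ^ (2 * m + 1) + ‖v‖ ^ (2 * (m + 1)) * ‖h‖
        ≤ (2 * ((m + 1 : ℕ) : ℝ)) * (‖v‖ * ‖h‖) * ‖v‖ ^ (2 * m + 1) +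
          ‖v‖ ^ (2 * (m + 1)) * ‖h‖ := by gcongr
      _ = _ := by push_cast; ring

/-- Summing e_i ⟨v, e_i⟩ rebuilds a factor v. For odd k the second part of the derivative has a
scalar factor v^{k-1}, and ∑ e_i e_i = -n brings in the dimension. -/
theorem sum_e_mul_vecPowDeriv {n : ℕ} (k : ℕ) (v : EuclideanSpace ℝ (Fin n)) :
    ∑ i, e i * vecPowDeriv k v (EuclideanSpace.single i 1) =
      -diracCoeff n k • vec n v ^ (k - 1) := by
  have hin (c : ℝ) (w : RealClifford n) :
      ∑ i, e i * ((c * inner ℝ v (EuclideanSpace.single i 1)) • w) = c • (vec n v * w) := by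
    rw [vec_eq_sum, Finset.sum_mul, Finset.smul_sum]
    refine Finset.sum_congr rfl fun i _ => ?_
    rw [EuclideanSpace.inner_single_right, mul_smul_comm, mul_smul, smul_mul_assoc]
    simp
  obtain ⟨m, rfl | rfl⟩ := k.even_or_odd'
  · simp_rw [vecPowDeriv_two_mul_apply]
    rw [hin, diracCoeff_two_mul]
    rcases m with _ | m
    · simp
    · rw [show 2 * (m + 1) - 2 = 2 * m by omega, show 2 * (m + 1) - 1 = 2 * m + 1 by omega, pow_succ']
  · simp_rw [vecPowDeriv_two_mul_add_one_apply, mul_add]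
    rw [Finset.sum_add_distrib, hin, diracCoeff_two_mul_add_one]
    simp_rw [mul_smul_comm, vec_single, e_mul_self]
    rw [← Finset.smul_sum, Nat.add_sub_cancel]
    have h1 : ∑ _i : Fin n, (-1 : RealClifford n) = -(n : ℝ) • 1 := by
      simp [Nat.cast_smul_eq_nsmul]
    rw [h1]
    rcases m with _ | m
    · simp
    · rw [show 2 * (m + 1) - 1 = 2 * m + 1 by omega, ← pow_succ',
        show 2 * m + 1 + 1 = 2 * (m + 1) by ring, vec_pow_two_mul]
      simp only [smul_smul, ← add_smul]
      congr 1
      ring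

end RealClifford

namespace Monogenic

open RealClifford
open Finset.HasAntidiagonal (antidiagonal)

/-! ### Exponential majorants and termwise differentiation -/

/-- The coefficients of `b` are majorized by those of `M exp(ρ t)`. -/
def ExpBound (M ρ : ℝ) (b : PowerSeries ℝ) : Prop :=
  0 ≤ ρ ∧ ∀ k, |PowerSeries.coeff k b| ≤ M * (ρ ^ k / k.factorial)

theorem ExpBound.nonneg {M ρ : ℝ} {b : PowerSeries ℝ} (hb : ExpBound M ρ b) : 0 ≤ M := by
  simpa using (abs_nonneg _).trans (hb.2 0)

theorem ExpBound.mono {M M' ρ ρ' : ℝ} {b : PowerSeries ℝ} (hb : ExpBound M ρ b) (hM : M ≤ M')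
    (hρ : ρ ≤ ρ') : ExpBound M' ρ' b := by
  have h0 := hb.1
  have hM0 := hb.nonneg.trans hM
  refine ⟨h0.trans hρ, fun k => (hb.2 k).trans ?_⟩
  gcongr

theorem ExpBound.summable_mul_pow {M ρ : ℝ} {b : PowerSeries ℝ} (hb : ExpBound M ρ b) {r : ℝ}
    (hr : 0 ≤ r) : Summable fun k => |PowerSeries.coeff k b| * r ^ k := by
  refine .of_nonneg_of_le (fun k => by positivity) (fun k => ?_)
    ((Real.summable_pow_div_factorial (ρ * r)).mul_left M)
  calc |PowerSeries.coeff k b| * r ^ k ≤ M * (ρ ^ k / k.factorial) * r ^ k := by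
        gcongr; exact hb.2 k
    _ = _ := by rw [mul_pow]; ring

theorem ExpBound.summable_smul {E : Type*} [NormedAddCommGroup E] [NormedSpace ℝ E]
    [CompleteSpace E] {M ρ : ℝ} {b : PowerSeries ℝ} (hb : ExpBound M ρ b) {r : ℝ} (hr : 0 ≤ r)
    {u : ℕ → E} (hu : ∀ k, ‖u k‖ ≤ r ^ k) : Summable fun k => PowerSeries.coeff k b • u k := by
  refine .of_norm_bounded (hb.summable_mul_pow hr) fun k => ?_
  rw [norm_smul, Real.norm_eq_abs]
  gcongr
  exact hu k

theorem ExpBound.norm_tsum_smul_le {E : Type*} [NormedAddCommGroup E] [NormedSpace ℝ E]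
    {M ρ : ℝ} {b : PowerSeries ℝ} (hb : ExpBound M ρ b) {r : ℝ}
    {u : ℕ → E} (hu : ∀ k, ‖u k‖ ≤ r ^ k) :
    ‖∑' k, PowerSeries.coeff k b • u k‖ ≤ M * Real.exp (ρ * r) := by
  have hexp : HasSum (fun k : ℕ => M * ((ρ * r) ^ k / k.factorial)) (M * Real.exp (ρ * r)) := by
    rw [Real.exp_eq_exp_ℝ]
    exact (NormedSpace.expSeries_div_hasSum_exp (ρ * r)).mul_left M
  refine tsum_of_norm_bounded hexp fun k => ?_
  rw [norm_smul, Real.norm_eq_abs]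
  calc |PowerSeries.coeff k b| * ‖u k‖ ≤ M * (ρ ^ k / k.factorial) * r ^ k := by
        gcongr
        · exact (abs_nonneg _).trans (hb.2 k)
        · exact hb.2 k
        · exact hu k
    _ = _ := by rw [mul_pow]; ring

section Termwise

variable {E F : Type*} [NormedAddCommGroup E] [NormedSpace ℝ E] [NormedAddCommGroup F]
  [NormedSpace ℝ F] {M ρ K : ℝ} {b : PowerSeries ℝ} {u : ℕ → E → F}
  {u' : ℕ → E → E →L[ℝ] F}

/-- The factor k is absorbed by k ≤ 2^k and the lowered exponent by a base 1 + R ≥ 1, leaving a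
geometric factor that the factorial decay of the coefficients beats. -/
theorem norm_smul_deriv_le (b : PowerSeries ℝ) (hK : 0 ≤ K)
    (hu' : ∀ k x, ‖u' k x‖ ≤ k * K ^ k * ‖x‖ ^ (k - 1)) {R : ℝ} (k : ℕ) (x : E) (hx : ‖x‖ ≤ R) :
    ‖PowerSeries.coeff k b • u' k x‖ ≤ |PowerSeries.coeff k b| * (2 * K * (1 + R)) ^ k := by
  have hR : 0 ≤ R := (norm_nonneg x).trans hx
  rw [norm_smul, Real.norm_eq_abs, mul_pow, mul_pow]
  gcongr
  refine (hu' k x).trans ?_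
  gcongr
  · exact_mod_cast k.lt_two_pow_self.le
  · calc ‖x‖ ^ (k - 1) ≤ (1 + R) ^ (k - 1) := by gcongr; linarith
      _ ≤ (1 + R) ^ k := pow_le_pow_right₀ (by linarith) (Nat.sub_le _ _)

theorem ExpBound.summable_smul_deriv [CompleteSpace F] (hb : ExpBound M ρ b) (hK : 0 ≤ K)
    (hu' : ∀ k x, ‖u' k x‖ ≤ k * K ^ k * ‖x‖ ^ (k - 1)) (x : E) :
    Summable fun k => PowerSeries.coeff k b • u' k x :=
  .of_norm_bounded (hb.summable_mul_pow (r := 2 * K * (1 + ‖x‖)) (by positivity))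
    fun k => norm_smul_deriv_le b hK hu' k x le_rfl

theorem ExpBound.hasFDerivAt_tsum [CompleteSpace F] (hb : ExpBound M ρ b) (hK : 0 ≤ K)
    (hu : ∀ k x, HasFDerivAt (u k) (u' k x) x)
    (hu' : ∀ k x, ‖u' k x‖ ≤ k * K ^ k * ‖x‖ ^ (k - 1))
    (h0 : Summable fun k => PowerSeries.coeff k b • u k 0) (x : E) :
    HasFDerivAt (fun x => ∑' k, PowerSeries.coeff k b • u k x)
      (∑' k, PowerSeries.coeff k b • u' k x) x := by
  have hR : 0 < ‖x‖ + 1 := by positivity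
  refine hasFDerivAt_tsum_of_isPreconnected
    (hb.summable_mul_pow (r := 2 * K * (1 + (‖x‖ + 1))) (by positivity)) Metric.isOpen_ball
    (convex_ball (0 : E) (‖x‖ + 1)).isPreconnected (fun k y _ => (hu k y).const_smul _)
    (fun k y hy => norm_smul_deriv_le b hK hu' k y ?_) (Metric.mem_ball_self hR) h0 ?_
  · exact (mem_ball_zero_iff.1 hy).le
  · rw [mem_ball_zero_iff]
    linarith

theorem ExpBound.continuous_tsum_deriv [CompleteSpace F] (hb : ExpBound M ρ b) (hK : 0 ≤ K)
    (hu' : ∀ k x, ‖u' k x‖ ≤ k * K ^ k * ‖x‖ ^ (k - 1)) (hc : ∀ k, Continuous (u' k)) :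
    Continuous fun x => ∑' k, PowerSeries.coeff k b • u' k x := by
  rw [continuous_iff_continuousAt]
  intro x
  have hx : Metric.ball (0 : E) (‖x‖ + 1) ∈ nhds x :=
    Metric.isOpen_ball.mem_nhds (by rw [mem_ball_zero_iff]; linarith)
  refine ContinuousOn.continuousAt (continuousOn_tsum
    (fun k => ((hc k).const_smul (PowerSeries.coeff k b)).continuousOn)
    (hb.summable_mul_pow (r := 2 * K * (1 + (‖x‖ + 1))) (by positivity)) fun k y hy => ?_) hx
  exact norm_smul_deriv_le b hK hu' k y (mem_ball_zero_iff.1 hy).le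

end Termwise

/-! ### Power series in a vector variable: smoothness -/

/-- The function `v ↦ ∑ b_k v^k` on `ℝⁿ ⊆ ℝ_n`. -/
noncomputable def vecSeries {n : ℕ} (b : PowerSeries ℝ) (v : EuclideanSpace ℝ (Fin n)) :
    RealClifford n :=
  ∑' k, PowerSeries.coeff k b • vec n v ^ k

theorem ExpBound.hasSum_vecSeries {n : ℕ} {M ρ : ℝ} {b : PowerSeries ℝ} (hb : ExpBound M ρ b)
    (v : EuclideanSpace ℝ (Fin n)) :
    HasSum (fun k => PowerSeries.coeff k b • vec n v ^ k) (vecSeries b v) :=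
  (hb.summable_smul (norm_nonneg v) fun k => (norm_vec_pow v k).le).hasSum

theorem norm_vecPowDeriv_le' {n : ℕ} (k : ℕ) (v : EuclideanSpace ℝ (Fin n)) :
    ‖vecPowDeriv k v‖ ≤ k * 1 ^ k * ‖v‖ ^ (k - 1) := by
  simpa using norm_vecPowDeriv_le k v

theorem ExpBound.hasFDerivAt_vecSeries {n : ℕ} {M ρ : ℝ} {b : PowerSeries ℝ} (hb : ExpBound M ρ b)
    (v : EuclideanSpace ℝ (Fin n)) :
    HasFDerivAt (vecSeries b) (∑' k, PowerSeries.coeff k b • vecPowDeriv k v) v :=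
  hb.hasFDerivAt_tsum zero_le_one hasFDerivAt_vec_pow norm_vecPowDeriv_le'
    (hb.hasSum_vecSeries 0).summable v

/-- The coefficients of the factor of `⟨v, h⟩` in the derivative of `∑ b_k v^k`. -/
noncomputable def innerShift (b : PowerSeries ℝ) : PowerSeries ℝ :=
  .mk fun k => -(2 * ((k + 2) / 2 : ℕ) : ℝ) * PowerSeries.coeff (k + 2) b

/-- The coefficients of the left factor of `h` in the derivative of `∑ b_k v^k`. -/
noncomputable def evenShift (b : PowerSeries ℝ) : PowerSeries ℝ :=
  .mk fun k => if Even k then PowerSeries.coeff (k + 1) b else 0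

/-- The differentiation factor, at most k + 2, is cancelled by (k+2)!, so the rate ρ survives and
only the constant changes. This lets the smoothness induction repeat indefinitely. -/
theorem ExpBound.innerShift {M ρ : ℝ} {b : PowerSeries ℝ} (hb : ExpBound M ρ b) :
    ExpBound (M * ρ ^ 2) ρ (innerShift b) := by
  have hM := hb.nonneg
  have hρ := hb.1
  refine ⟨hb.1, fun k => ?_⟩
  rw [Monogenic.innerShift, PowerSeries.coeff_mk, abs_mul, abs_neg,
    abs_of_nonneg (by positivity : (0 : ℝ) ≤ 2 * ((k + 2) / 2 : ℕ))]
  have h2 : (2 * ((k + 2) / 2 : ℕ) : ℝ) ≤ k + 2 := by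
    exact_mod_cast (by omega : 2 * ((k + 2) / 2) ≤ k + 2)
  calc (2 * ((k + 2) / 2 : ℕ) : ℝ) * |PowerSeries.coeff (k + 2) b|
      ≤ (k + 2) * (M * (ρ ^ (k + 2) / (k + 2).factorial)) := by
        gcongr
        exact hb.2 _
    _ = M * ρ ^ 2 * (ρ ^ k / ((k + 1) * k.factorial)) := by
        rw [Nat.factorial_succ, Nat.factorial_succ]
        push_cast
        field_simp
        ring
    _ ≤ M * ρ ^ 2 * (ρ ^ k / k.factorial) := by
        gcongr
        exact le_mul_of_one_le_left (by positivity) (by linarith [k.cast_nonneg (α := ℝ)])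

theorem ExpBound.evenShift {M ρ : ℝ} {b : PowerSeries ℝ} (hb : ExpBound M ρ b) :
    ExpBound (M * ρ) ρ (evenShift b) := by
  have hM := hb.nonneg
  have hρ := hb.1
  refine ⟨hb.1, fun k => ?_⟩
  rw [Monogenic.evenShift, PowerSeries.coeff_mk]
  split_ifs
  · refine (hb.2 _).trans ?_
    rw [Nat.factorial_succ, pow_succ']
    push_cast
    rw [mul_assoc, mul_div_assoc]
    gcongr
    exact le_mul_of_one_le_left (by positivity) (by linarith [k.cast_nonneg (α := ℝ)])
  · rw [abs_zero]
    positivity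

/-- Shifting the index by 2 loses nothing: the dropped terms carry the factor k / 2 = 0. -/
theorem hasSum_innerShift {E : Type*} [NormedAddCommGroup E] [NormedSpace ℝ E] {b : PowerSeries ℝ}
    {u : ℕ → E} {s : E} (hs : HasSum (fun k => PowerSeries.coeff k (innerShift b) • u k) s) :
    HasSum (fun k => PowerSeries.coeff k b • (-(2 * (k / 2 : ℕ)) : ℝ) • u (k - 2)) s := by
  rw [← hasSum_nat_add_iff' 2]
  simpa [Finset.sum_range_succ, innerShift, smul_smul, mul_comm] using hs

theorem hasSum_evenShift {E : Type*} [NormedAddCommGroup E] [NormedSpace ℝ E] {b : PowerSeries ℝ}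
    {u : ℕ → E} {s : E} (hs : HasSum (fun k => PowerSeries.coeff k (evenShift b) • u k) s) :
    HasSum (fun k => PowerSeries.coeff k b • if Even k then 0 else u (k - 1)) s := by
  rw [← hasSum_nat_add_iff' 1]
  simpa [evenShift, Nat.even_add_one, ite_smul, smul_ite, ← Nat.not_even_iff_odd, ite_not] using hs

theorem ExpBound.tsum_smul_vecPowDeriv {n : ℕ} {M ρ : ℝ} {b : PowerSeries ℝ}
    (hb : ExpBound M ρ b) (v : EuclideanSpace ℝ (Fin n)) :
    ∑' k, PowerSeries.coeff k b • vecPowDeriv k v =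
      (innerSL ℝ v).smulRight (vecSeries (Monogenic.innerShift b) v) +
        (mulCLM n (vecSeries (Monogenic.evenShift b) v)).comp (vec n) := by
  ext h
  have hs := (hb.summable_smul_deriv (u' := vecPowDeriv) zero_le_one
    (norm_vecPowDeriv_le' (n := n)) v).hasSum
  have h1 := (ContinuousLinearMap.apply ℝ (RealClifford n) h).hasSum hs
  refine h1.unique ?_
  have h2 : HasSum _ (inner ℝ v h • vecSeries (Monogenic.innerShift b) v) :=
    (hasSum_innerShift (hb.innerShift.hasSum_vecSeries v)).const_smul (inner ℝ v h)
  have h3 : HasSum _ (vecSeries (Monogenic.evenShift b) v * vec n h) :=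
    (hasSum_evenShift (hb.evenShift.hasSum_vecSeries v)).mul_right (vec n h)
  refine (h2.add h3).congr_fun fun k => ?_
  have h4 : (if Even k then 0 else (mulCLM n (vec n v ^ (k - 1))).comp (vec n)) h =
      (if Even k then 0 else vec n v ^ (k - 1)) * vec n h := by
    split_ifs <;> simp
  simp only [ContinuousLinearMap.apply_apply, smul_apply, vecPowDeriv,
    add_apply, h4, smul_add, smul_mul_assoc]
  congr 1
  simp only [ContinuousLinearMap.smulRight_apply, innerSL_apply_apply, smul_smul]
  congr 1
  ring

/-- The derivative is assembled linearly from two series of the same kind with shifted coefficients,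
so the induction must allow `M` and `b` to vary. -/
theorem ExpBound.contDiff_vecSeries {n : ℕ} (N : ℕ) {M ρ : ℝ} {b : PowerSeries ℝ}
    (hb : ExpBound M ρ b) : ContDiff ℝ N (vecSeries (n := n) b) := by
  induction N generalizing M b with
  | zero =>
    exact contDiff_zero.2 (continuous_iff_continuousAt.2 fun v =>
      (hb.hasFDerivAt_vecSeries v).continuousAt)
  | succ N ih =>
    push_cast
    refine contDiff_succ_iff_hasFDerivAt.2 ⟨fun v => (innerSL ℝ v).smulRight
      (vecSeries (Monogenic.innerShift b) v) +
        (mulCLM n (vecSeries (Monogenic.evenShift b) v)).comp (vec n), ?_, fun v => ?_⟩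
    · exact ((innerSL ℝ).contDiff.smulRight (ih hb.innerShift)).add
        (((mulCLM n).contDiff.comp (ih hb.evenShift)).clm_comp contDiff_const)
    · exact (hb.hasFDerivAt_vecSeries v).congr_fderiv (hb.tsum_smul_vecPowDeriv v)

/-! ### The Dirac operator, the Laplacian and their action on coefficients -/

/-- The Dirac operator `∑ e_i ∂_{x_i}` of `ℝⁿ`. -/
noncomputable def dirac {n : ℕ} (f : EuclideanSpace ℝ (Fin n) → RealClifford n)
    (v : EuclideanSpace ℝ (Fin n)) : RealClifford n :=
  ∑ i, e i * fderiv ℝ f v (EuclideanSpace.single i 1)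

theorem laplacian_eq_neg_dirac_dirac {n : ℕ} {f : EuclideanSpace ℝ (Fin n) → RealClifford n}
    (hf : ContDiff ℝ 2 f) : Laplacian.laplacian f = fun v => -dirac (dirac f) v := by
  funext v
  set H : Fin n → Fin n → RealClifford n := fun i j =>
    fderiv ℝ (fderiv ℝ f) v (EuclideanSpace.single i 1) (EuclideanSpace.single j 1) with hH
  have hsymm (i j : Fin n) : H i j = H j i :=
    hf.contDiffAt.isSymmSndFDerivAt (by simp) _ _
  have hdd : dirac (dirac f) v = ∑ i, ∑ j, e i * e j * H i j := by
    have hd : HasFDerivAt (dirac f) (∑ j : Fin n, ((mulCLM n (e j)).comp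
        (ContinuousLinearMap.apply ℝ (RealClifford n) (EuclideanSpace.single j (1 : ℝ)))).comp
          (fderiv ℝ (fderiv ℝ f) v)) v := by
      have h1 : HasFDerivAt (fderiv ℝ f) (fderiv ℝ (fderiv ℝ f) v) v :=
        ((hf.fderiv_right (m := 1) (by norm_num)).differentiable (by norm_num) v).hasFDerivAt
      exact HasFDerivAt.fun_sum fun j _ => ((mulCLM n (e j)).comp (ContinuousLinearMap.apply ℝ
        (RealClifford n) (EuclideanSpace.single j (1 : ℝ)))).hasFDerivAt.comp v h1
    rw [dirac]
    simp [hd.fderiv, Finset.mul_sum, mul_assoc, hH]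
  have hL : Laplacian.laplacian f v = ∑ i, H i i := by
    rw [InnerProductSpace.laplacian_eq_iteratedFDeriv_orthonormalBasis f
      (EuclideanSpace.basisFun (Fin n) ℝ)]
    simp [iteratedFDeriv_two_apply, hH]
  -- Adding the double sum to its transpose makes e_i e_j + e_j e_i appear against the symmetric
  -- Hessian; only the diagonal survives.
  have h2 : dirac (dirac f) v + dirac (dirac f) v = (-∑ i, H i i) + -∑ i, H i i := by
    conv_lhs => rw [hdd]; rhs; rw [Finset.sum_comm]
    simp_rw [← Finset.sum_neg_distrib, ← Finset.sum_add_distrib]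
    refine Finset.sum_congr rfl fun i _ => ?_
    rw [Finset.sum_eq_single i]
    · rw [e_mul_self, neg_one_mul]
    · intro j _ hij
      rw [hsymm j i, e_mul_e_of_ne hij]
      simp
    · simp
  have h3 : (2 : ℝ) • dirac (dirac f) v = (2 : ℝ) • -∑ i, H i i := by
    rw [two_smul, two_smul, h2]
  rw [hL, smul_right_injective _ two_ne_zero h3, neg_neg]

/-- The coefficients of `∂ ∑ b_k v^k` for the Dirac operator `∂`. -/
noncomputable def diracShift (n : ℕ) (b : PowerSeries ℝ) : PowerSeries ℝ :=
  .mk fun k => -diracCoeff n (k + 1) * PowerSeries.coeff (k + 1) b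

theorem ExpBound.diracShift (n : ℕ) {M ρ : ℝ} {b : PowerSeries ℝ} (hb : ExpBound M ρ b) :
    ExpBound ((n + 1) * ρ * M) ρ (diracShift n b) := by
  have hM := hb.nonneg
  have hρ := hb.1
  refine ⟨hb.1, fun k => ?_⟩
  rw [Monogenic.diracShift, PowerSeries.coeff_mk, abs_mul, abs_neg,
    abs_of_nonneg (diracCoeff_nonneg _ _)]
  calc diracCoeff n (k + 1) * |PowerSeries.coeff (k + 1) b|
      ≤ ((n + 1) * (k + 1 : ℕ)) * (M * (ρ ^ (k + 1) / (k + 1).factorial)) := by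
        gcongr
        · exact diracCoeff_le _ _
        · exact hb.2 _
    _ = _ := by
        rw [Nat.factorial_succ]
        push_cast
        field_simp
        ring

theorem ExpBound.diracShift_iterate (n : ℕ) {M ρ : ℝ} {b : PowerSeries ℝ} (hb : ExpBound M ρ b)
    (j : ℕ) : ∃ M', ExpBound M' ρ ((Monogenic.diracShift n)^[j] b) := by
  induction j with
  | zero => exact ⟨M, hb⟩
  | succ j ih =>
    obtain ⟨M', h⟩ := ih
    rw [Function.iterate_succ_apply']
    exact ⟨_, h.diracShift n⟩

theorem ExpBound.dirac_vecSeries {n : ℕ} {M ρ : ℝ} {b : PowerSeries ℝ} (hb : ExpBound M ρ b) :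
    dirac (vecSeries (n := n) b) = vecSeries (Monogenic.diracShift n b) := by
  funext v
  rw [dirac, (hb.hasFDerivAt_vecSeries v).fderiv]
  have hs := (hb.summable_smul_deriv (u' := vecPowDeriv) zero_le_one
    (norm_vecPowDeriv_le' (n := n)) v).hasSum
  have h1 : HasSum _ (∑ i : Fin n, e i * (∑' k, PowerSeries.coeff k b • vecPowDeriv k v)
      (EuclideanSpace.single i 1)) :=
    hasSum_sum fun i _ => ((ContinuousLinearMap.apply ℝ (RealClifford n)
      (EuclideanSpace.single i (1 : ℝ))).hasSum hs).mul_left (e i)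
  refine h1.unique ?_
  have h2 : HasSum (fun k => (-diracCoeff n k * PowerSeries.coeff k b) • vec n v ^ (k - 1))
      (vecSeries (Monogenic.diracShift n b) v) := by
    rw [← hasSum_nat_add_iff' 1]
    simpa [Monogenic.diracShift] using (hb.diracShift n).hasSum_vecSeries v
  refine h2.congr_fun fun k => ?_
  simp only [ContinuousLinearMap.apply_apply, smul_apply, mul_smul_comm]
  rw [← Finset.smul_sum, sum_e_mul_vecPowDeriv, smul_smul, mul_comm]

theorem ExpBound.laplacian_iterate_vecSeries {n : ℕ} {M ρ : ℝ} {b : PowerSeries ℝ}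
    (hb : ExpBound M ρ b) (k : ℕ) :
    Laplacian.laplacian^[k] (vecSeries (n := n) b) =
      fun v => (-1 : ℝ) ^ k • vecSeries ((Monogenic.diracShift n)^[2 * k] b) v := by
  induction k with
  | zero => simp
  | succ k ih =>
    obtain ⟨M', h⟩ := hb.diracShift_iterate n (2 * k)
    rw [Function.iterate_succ_apply', ih]
    change Laplacian.laplacian ((-1 : ℝ) ^ k • vecSeries ((Monogenic.diracShift n)^[2 * k] b)) = _
    funext v
    rw [InnerProductSpace.laplacian_smul _ (h.contDiff_vecSeries 2).contDiffAt,
      laplacian_eq_neg_dirac_dirac (h.contDiff_vecSeries 2), h.dirac_vecSeries,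
      (h.diracShift n).dirac_vecSeries, show 2 * (k + 1) = 2 * k + 1 + 1 by ring,
      Function.iterate_succ_apply', Function.iterate_succ_apply']
    simp [pow_succ]

/-! ### Products of Dirac coefficients -/

/-- The product `c_{m+1} ⋯ c_{m+j}` of the coefficients `diracCoeff`. -/
noncomputable def diracProd (n m j : ℕ) : ℝ := ∏ i ∈ Finset.range j, diracCoeff n (m + i + 1)

@[simp] theorem diracProd_zero (n m : ℕ) : diracProd n m 0 = 1 := by simp [diracProd]

theorem diracProd_succ (n m j : ℕ) :
    diracProd n m (j + 1) = diracProd n m j * diracCoeff n (m + j + 1) := by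
  simp [diracProd, Finset.prod_range_succ]

theorem diracProd_succ' (n m j : ℕ) :
    diracProd n m (j + 1) = diracCoeff n (m + 1) * diracProd n (m + 1) j := by
  rw [diracProd, Finset.prod_range_succ', mul_comm, diracProd]
  congr 1
  exact Finset.prod_congr rfl fun i _ => by rw [show m + (i + 1) + 1 = m + 1 + i + 1 by ring]

theorem diracProd_nonneg (n m j : ℕ) : 0 ≤ diracProd n m j :=
  Finset.prod_nonneg fun _ _ => diracCoeff_nonneg _ _

/-- Each factor satisfies c_i ≤ (n+1) i, and the indices i = m+1, …, m+j multiply to (m+j)!/m!. -/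
theorem diracProd_mul_factorial_le (n m j : ℕ) :
    diracProd n m j * m.factorial ≤ (n + 1) ^ j * (m + j).factorial := by
  induction j with
  | zero => simp
  | succ j ih =>
    rw [diracProd_succ, ← add_assoc, Nat.factorial_succ]
    have h := diracCoeff_le n (m + j + 1)
    calc diracProd n m j * diracCoeff n (m + j + 1) * m.factorial
        = diracProd n m j * m.factorial * diracCoeff n (m + j + 1) := by ring
      _ ≤ (n + 1) ^ j * (m + j).factorial * ((n + 1) * (m + j + 1 : ℕ)) := by
          gcongr
          exact diracCoeff_nonneg _ _
      _ = _ := by push_cast; ring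

theorem diracProd_div_factorial_le (n m j : ℕ) :
    diracProd n m j / j.factorial ≤ (m + j).choose m * (n + 1) ^ j := by
  rw [Nat.cast_add_choose, div_le_iff₀ (by positivity)]
  calc diracProd n m j = diracProd n m j * m.factorial / m.factorial := by field_simp
    _ ≤ (n + 1) ^ j * (m + j).factorial / m.factorial := by
        gcongr ?_ / _
        exact diracProd_mul_factorial_le n m j
    _ = _ := by field_simp

theorem coeff_diracShift_iterate (n : ℕ) (b : PowerSeries ℝ) (j m : ℕ) :
    PowerSeries.coeff m ((diracShift n)^[j] b) =
      (-1) ^ j * diracProd n m j * PowerSeries.coeff (m + j) b := by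
  induction j generalizing m with
  | zero => simp
  | succ j ih =>
    rw [Function.iterate_succ_apply', diracShift, PowerSeries.coeff_mk, ih, diracProd_succ',
      show m + 1 + j = m + (j + 1) by ring]
    ring

/-! ### The polynomials P_k and their sharp bound -/

/-- The Cauchy-Kowalewski extension of `v ↦ v^k`. -/
noncomputable def ckPoly {n : ℕ} (k : ℕ) (x : Paravector n) : RealClifford n :=
  ∑ p ∈ antidiagonal k,
    (diracProd n p.1 p.2 / p.2.factorial * x 0 ^ p.2) • vec n (vecPart x) ^ p.1

/-- The complex counterpart of `ckPoly`. -/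
noncomputable def complexPoly (n k : ℕ) (t : ℝ) (z : ℂ) : ℂ :=
  ∑ p ∈ antidiagonal k, ((diracProd n p.1 p.2 / p.2.factorial * t ^ p.2 : ℝ) : ℂ) * z ^ p.1

/-- The map sending i to v/‖v‖ is isometric for v ≠ 0. For v = 0 the quotient is 0 by convention and
the imaginary part is dropped, which is why only an inequality holds. -/
theorem norm_smul_one_add_smul_vec_le {n : ℕ} (z : ℂ) (v : EuclideanSpace ℝ (Fin n)) :
    ‖z.re • (1 : RealClifford n) + (z.im / ‖v‖) • vec n v‖ ≤ ‖z‖ := by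
  rw [← sq_le_sq₀ (norm_nonneg _) (norm_nonneg _), norm_smul_one_add_smul_vec_sq, Complex.sq_norm,
    Complex.normSq_apply, ← mul_pow]
  by_cases hv : ‖v‖ = 0
  · simp only [hv, mul_zero]
    nlinarith [sq_nonneg z.im]
  · rw [div_mul_cancel₀ _ hv]
    exact le_of_eq (by ring)

theorem re_smul_one_add_im_smul_vec {n m : ℕ} (v : EuclideanSpace ℝ (Fin n)) :
    ((‖v‖ * Complex.I) ^ m : ℂ).re • (1 : RealClifford n) +
      (((‖v‖ * Complex.I) ^ m : ℂ).im / ‖v‖) • vec n v = vec n v ^ m := by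
  have h2 : ((‖v‖ * Complex.I) ^ 2 : ℂ) = ((-‖v‖ ^ 2 : ℝ) : ℂ) := by
    rw [mul_pow, Complex.I_sq]
    push_cast
    ring
  obtain ⟨l, rfl | rfl⟩ := m.even_or_odd'
  · rw [pow_mul, h2, ← Complex.ofReal_pow, vec_pow_two_mul]
    simp only [Complex.ofReal_re, Complex.ofReal_im]
    simp
  · rw [pow_succ, pow_mul, h2, ← Complex.ofReal_pow, ← mul_assoc, ← Complex.ofReal_mul,
      vec_pow_two_mul_add_one]
    by_cases hv : ‖v‖ = 0
    · simp [norm_eq_zero.1 hv]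
    · rw [Complex.re_ofReal_mul, Complex.im_ofReal_mul]
      simp [hv]

theorem norm_ckPoly_le_norm_complexPoly {n : ℕ} (k : ℕ) (x : Paravector n) :
    ‖ckPoly k x‖ ≤ ‖complexPoly n k (x 0) (‖vecPart x‖ * Complex.I)‖ := by
  refine le_of_eq_of_le (congrArg _ ?_) (norm_smul_one_add_smul_vec_le _ (vecPart x))
  rw [ckPoly, complexPoly, Complex.re_sum, Complex.im_sum, Finset.sum_div, Finset.sum_smul,
    Finset.sum_smul, ← Finset.sum_add_distrib]
  refine Finset.sum_congr rfl fun p _ => ?_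
  rw [← re_smul_one_add_im_smul_vec, Complex.re_ofReal_mul, Complex.im_ofReal_mul, smul_add,
    smul_smul, smul_smul, mul_div_assoc]

/-- The added term is b · i Im z, which enlarges the imaginary part without changing its sign. -/
theorem mul_norm_le_norm_add {a b : ℝ} (ha : 0 ≤ a) (hb : 0 ≤ b) (z : ℂ) :
    a * ‖z‖ ≤ ‖(a : ℂ) * z + b * ((z - (starRingEnd ℂ) z) / 2)‖ := by
  rw [← sq_le_sq₀ (by positivity) (norm_nonneg _), mul_pow, Complex.sq_norm, Complex.sq_norm,
    Complex.normSq_apply, Complex.normSq_apply]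
  have h : (z - (starRingEnd ℂ) z) / 2 = z.im * Complex.I := by
    rw [Complex.sub_conj]
    push_cast
    ring
  rw [h]
  simp
  have h1 : 0 ≤ (2 * a * b + b ^ 2) * z.im ^ 2 := by positivity
  nlinarith

/-- Since z = ri is imaginary and the coefficients are real, (w - w̄)/2 selects the odd powers of z.
The left side therefore multiplies the term t^j z^m by j + c_m. The share j lowers j! and gives t
Q_k; the share c_m extends the product c_{m+1} ⋯ c_{k+1} downwards and gives z Q_k. Both leave the
common last factor c_{k+1}. -/
theorem complexPoly_succ (n k : ℕ) (t r : ℝ) :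
    ((k + 1 : ℕ) : ℝ) * complexPoly n (k + 1) t (r * Complex.I) + ((n - 1 : ℝ) : ℂ) *
      ((complexPoly n (k + 1) t (r * Complex.I) -
        (starRingEnd ℂ) (complexPoly n (k + 1) t (r * Complex.I))) / 2) =
      diracCoeff n (k + 1) * ((t + r * Complex.I) * complexPoly n k t (r * Complex.I)) := by
  set z : ℂ := r * Complex.I with hz
  have hconj : (starRingEnd ℂ) z = -z := by simp [hz]
  have hL : ∀ p ∈ antidiagonal (k + 1),
      ((k + 1 : ℕ) : ℝ) * (((diracProd n p.1 p.2 / p.2.factorial * t ^ p.2 : ℝ) : ℂ) * z ^ p.1) +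
        ((n - 1 : ℝ) : ℂ) * ((((diracProd n p.1 p.2 / p.2.factorial * t ^ p.2 : ℝ) : ℂ) * z ^ p.1 -
          (starRingEnd ℂ) (((diracProd n p.1 p.2 / p.2.factorial * t ^ p.2 : ℝ) : ℂ) * z ^ p.1)) / 2)
        = ((diracProd n p.1 p.2 / p.2.factorial * t ^ p.2 * p.2 : ℝ) : ℂ) * z ^ p.1 +
          ((diracCoeff n p.1 * diracProd n p.1 p.2 / p.2.factorial * t ^ p.2 : ℝ) : ℂ) *
            z ^ p.1 := by
    intro p hp
    rw [← Finset.HasAntidiagonal.mem_antidiagonal.1 hp, map_mul, map_pow, hconj, Complex.conj_ofReal, neg_pow,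
      diracCoeff]
    push_cast
    ring
  have h1 : ∑ p ∈ antidiagonal (k + 1),
      ((diracProd n p.1 p.2 / p.2.factorial * t ^ p.2 * p.2 : ℝ) : ℂ) * z ^ p.1 =
        diracCoeff n (k + 1) * (t * complexPoly n k t z) := by
    rw [Finset.Nat.sum_antidiagonal_succ', complexPoly, Finset.mul_sum, Finset.mul_sum]
    simp only [Nat.cast_zero, mul_zero, Complex.ofReal_zero, zero_mul, zero_add]
    refine Finset.sum_congr rfl fun p hp => ?_
    rw [diracProd_succ, Finset.HasAntidiagonal.mem_antidiagonal.1 hp, Nat.factorial_succ]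
    push_cast
    have : (p.2 : ℂ) + 1 ≠ 0 := Nat.cast_add_one_ne_zero _
    field_simp
    ring
  have h2 : ∑ p ∈ antidiagonal (k + 1),
      ((diracCoeff n p.1 * diracProd n p.1 p.2 / p.2.factorial * t ^ p.2 : ℝ) : ℂ) * z ^ p.1 =
        diracCoeff n (k + 1) * (z * complexPoly n k t z) := by
    rw [Finset.Nat.sum_antidiagonal_succ, complexPoly, Finset.mul_sum, Finset.mul_sum]
    simp only [diracCoeff_zero, zero_mul, zero_div, Complex.ofReal_zero, zero_add]
    refine Finset.sum_congr rfl fun p hp => ?_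
    rw [← diracProd_succ', diracProd_succ, Finset.HasAntidiagonal.mem_antidiagonal.1 hp]
    push_cast
    ring
  rw [add_mul, mul_add, ← h1, ← h2, ← Finset.sum_add_distrib, ← Finset.sum_congr rfl hL,
    Finset.sum_add_distrib, ← Finset.mul_sum, ← Finset.mul_sum, ← Finset.sum_div,
    Finset.sum_sub_distrib, ← map_sum]
  rfl

theorem norm_complexPoly_le {n : ℕ} (hn : 1 ≤ n) (k : ℕ) (t r : ℝ) :
    ‖complexPoly n k t (r * Complex.I)‖ ≤ (n * ‖(t + r * Complex.I : ℂ)‖) ^ k := by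
  induction k with
  | zero => simp [complexPoly]
  | succ k ih =>
    have hn' : (0 : ℝ) ≤ n - 1 := by
      have : (1 : ℝ) ≤ n := by exact_mod_cast hn
      linarith
    have h := mul_norm_le_norm_add (Nat.cast_nonneg (k + 1)) hn'
      (complexPoly n (k + 1) t (r * Complex.I))
    rw [complexPoly_succ, norm_mul, norm_mul, Complex.norm_real, Real.norm_eq_abs,
      abs_of_nonneg (diracCoeff_nonneg _ _)] at h
    refine le_of_mul_le_mul_left (h.trans ?_) (by positivity : (0 : ℝ) < (k + 1 : ℕ))
    calc diracCoeff n (k + 1) * (‖(t + r * Complex.I : ℂ)‖ * ‖complexPoly n k t (r * Complex.I)‖)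
        ≤ (n * (k + 1 : ℕ)) *
          (‖(t + r * Complex.I : ℂ)‖ * (n * ‖(t + r * Complex.I : ℂ)‖) ^ k) := by
          gcongr
          exact diracCoeff_le_of_one_le hn _
      _ = _ := by ring

theorem norm_sq_eq_add_norm_vecPart_sq {n : ℕ} (x : Paravector n) :
    ‖x‖ ^ 2 = x 0 ^ 2 + ‖vecPart x‖ ^ 2 := by
  simp [EuclideanSpace.norm_sq_eq, Fin.sum_univ_succ, vecPart]

theorem norm_ckPoly_le {n : ℕ} (k : ℕ) (x : Paravector n) : ‖ckPoly k x‖ ≤ (n * ‖x‖) ^ k := by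
  -- For n = 0 the recursion is useless, as n - 1 < 0; there P_k vanishes for k ≥ 1 because v = 0
  -- and c_1 = 0.
  rcases n.eq_zero_or_pos with rfl | hn
  · rcases k with _ | k
    · simp [ckPoly]
    · have hv : vecPart x = 0 := Subsingleton.elim _ _
      have : ckPoly (k + 1) x = 0 := by
        rw [ckPoly, Finset.Nat.sum_antidiagonal_succ, diracProd_succ']
        simp [hv, show diracCoeff 0 1 = 0 by simpa using diracCoeff_two_mul_add_one 0 0]
      simp [this]
  · have hx : ‖(x 0 + ‖vecPart x‖ * Complex.I : ℂ)‖ = ‖x‖ := by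
      rw [← sq_eq_sq₀ (norm_nonneg _) (norm_nonneg _), norm_sq_eq_add_norm_vecPart_sq,
        Complex.sq_norm, Complex.normSq_add_mul_I]
    rw [← hx]
    exact (norm_ckPoly_le_norm_complexPoly k x).trans (norm_complexPoly_le hn k _ _)

/-! ### Derivatives and monogenicity of P_k -/

/-- The projection `vecPart` as a continuous linear map. -/
noncomputable def vecPartCLM (n : ℕ) : Paravector n →L[ℝ] EuclideanSpace ℝ (Fin n) :=
  LinearMap.toContinuousLinearMap
    { toFun := vecPart
      map_add' := fun _ _ => rfl
      map_smul' := fun _ _ => rfl }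

@[simp] theorem vecPartCLM_apply {n : ℕ} (x : Paravector n) : vecPartCLM n x = vecPart x := rfl

theorem norm_vecPart_le {n : ℕ} (x : Paravector n) : ‖vecPart x‖ ≤ ‖x‖ := by
  rw [← sq_le_sq₀ (norm_nonneg _) (norm_nonneg _), norm_sq_eq_add_norm_vecPart_sq x]
  nlinarith [sq_nonneg (x 0)]

theorem abs_apply_zero_le {n : ℕ} (x : Paravector n) : |x 0| ≤ ‖x‖ := by
  rw [← sq_le_sq₀ (abs_nonneg _) (norm_nonneg _), norm_sq_eq_add_norm_vecPart_sq x, sq_abs]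
  nlinarith [sq_nonneg ‖vecPart x‖]

@[simp] theorem vecPart_single_zero (n : ℕ) :
    vecPart (EuclideanSpace.single (0 : Fin (n + 1)) (1 : ℝ)) = 0 := by
  ext i
  simp [vecPart]

@[simp] theorem vecPart_single_succ {n : ℕ} (i : Fin n) :
    vecPart (EuclideanSpace.single i.succ (1 : ℝ)) = EuclideanSpace.single i 1 := by
  ext j
  simp [vecPart]

@[simp] theorem vecPart_ofVec {n : ℕ} (v : EuclideanSpace ℝ (Fin n)) : vecPart (ofVec v) = v := by
  ext i
  simp [vecPart, ofVec]

@[simp] theorem ofVec_zero_apply {n : ℕ} (v : EuclideanSpace ℝ (Fin n)) : ofVec v 0 = 0 := by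
  simp [ofVec]

/-- The coordinate `x_0` as a continuous linear map. -/
noncomputable def scalarPart (n : ℕ) : Paravector n →L[ℝ] ℝ := EuclideanSpace.proj 0

@[simp] theorem scalarPart_apply {n : ℕ} (x : Paravector n) : scalarPart n x = x 0 := rfl

theorem hasFDerivAt_apply_zero_pow {n : ℕ} (j : ℕ) (x : Paravector n) :
    HasFDerivAt (fun x : Paravector n => x 0 ^ j) ((j * x 0 ^ (j - 1)) • scalarPart n) x := by
  refine ((scalarPart n).hasFDerivAt.pow j).congr_fderiv ?_
  ext h
  simp

/-- The derivative of `ckPoly k`. -/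
noncomputable def ckPolyDeriv {n : ℕ} (k : ℕ) (x : Paravector n) :
    Paravector n →L[ℝ] RealClifford n :=
  ∑ p ∈ antidiagonal k, (diracProd n p.1 p.2 / p.2.factorial) •
    (x 0 ^ p.2 • (vecPowDeriv p.1 (vecPart x)).comp (vecPartCLM n) +
      ((p.2 * x 0 ^ (p.2 - 1)) • scalarPart n).smulRight (vec n (vecPart x) ^ p.1))

theorem hasFDerivAt_ckPoly {n : ℕ} (k : ℕ) (x : Paravector n) :
    HasFDerivAt (ckPoly (n := n) k) (ckPolyDeriv k x) x := by
  have h : ckPoly (n := n) k = fun x => ∑ p ∈ antidiagonal k,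
      (diracProd n p.1 p.2 / p.2.factorial) • (x 0 ^ p.2 • vec n (vecPart x) ^ p.1) := by
    funext y
    simp_rw [ckPoly, mul_smul]
  rw [h]
  exact HasFDerivAt.fun_sum fun p _ => HasFDerivAt.fun_const_smul
    ((hasFDerivAt_apply_zero_pow p.2 x).fun_smul
      ((hasFDerivAt_vec_pow p.1 (vecPart x)).comp x (vecPartCLM n).hasFDerivAt)) _

/-- A crude base n + 2 suffices: the bound serves only to differentiate series termwise, not to
measure growth. -/
theorem norm_ckPolyDeriv_le {n : ℕ} (k : ℕ) (x : Paravector n) :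
    ‖ckPolyDeriv k x‖ ≤ k * (n + 2 : ℝ) ^ k * ‖x‖ ^ (k - 1) := by
  -- The weights are arranged as terms of the binomial expansion of (1 + (n+1))^k.
  have hterm : ∀ p ∈ antidiagonal k, ‖(diracProd n p.1 p.2 / p.2.factorial) •
      (x 0 ^ p.2 • (vecPowDeriv p.1 (vecPart x)).comp (vecPartCLM n) +
        ((p.2 * x 0 ^ (p.2 - 1)) • scalarPart n).smulRight (vec n (vecPart x) ^ p.1))‖ ≤
      (k * ‖x‖ ^ (k - 1)) * (k.choose p.1 • (1 ^ p.1 * (n + 1 : ℝ) ^ p.2)) := by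
    intro p hp
    rw [Finset.HasAntidiagonal.mem_antidiagonal] at hp
    have h1 : ‖x 0 ^ p.2 • (vecPowDeriv p.1 (vecPart x)).comp (vecPartCLM n)‖ ≤
        p.1 * ‖x‖ ^ (k - 1) := by
      rcases hm : p.1 with _ | m
      · simp [vecPowDeriv]
      rw [norm_smul, norm_pow, Real.norm_eq_abs, ← hp, hm, show m + 1 + p.2 - 1 = p.2 + m by omega]
      have hv : ‖vecPartCLM n‖ ≤ 1 :=
        ContinuousLinearMap.opNorm_le_bound _ zero_le_one fun h => by simpa using norm_vecPart_le h
      calc |x 0| ^ p.2 * ‖(vecPowDeriv (m + 1) (vecPart x)).comp (vecPartCLM n)‖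
          ≤ ‖x‖ ^ p.2 * (((m + 1 : ℕ) * ‖x‖ ^ m) * 1) := by
            gcongr
            · exact abs_apply_zero_le x
            · refine (ContinuousLinearMap.opNorm_comp_le _ _).trans ?_
              gcongr
              refine (norm_vecPowDeriv_le _ _).trans ?_
              rw [Nat.add_sub_cancel]
              gcongr
              exact norm_vecPart_le x
        _ = _ := by ring
    have h2 : ‖((p.2 * x 0 ^ (p.2 - 1)) • scalarPart n).smulRight (vec n (vecPart x) ^ p.1)‖ ≤
        p.2 * ‖x‖ ^ (k - 1) := by
      rcases hj : p.2 with _ | j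
      · simp
      have hs : ‖scalarPart n‖ ≤ 1 :=
        ContinuousLinearMap.opNorm_le_bound _ zero_le_one fun h => by
          simpa using abs_apply_zero_le h
      rw [ContinuousLinearMap.norm_smulRight_apply, norm_smul, norm_vec_pow, norm_mul, norm_pow,
        Real.norm_eq_abs (x 0), Real.norm_natCast, ← hp, hj,
        show p.1 + (j + 1) - 1 = j + p.1 by omega, Nat.add_sub_cancel]
      calc ((j + 1 : ℕ) : ℝ) * |x 0| ^ j * ‖scalarPart n‖ * ‖vecPart x‖ ^ p.1
          ≤ ((j + 1 : ℕ) : ℝ) * ‖x‖ ^ j * 1 * ‖x‖ ^ p.1 := by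
            gcongr
            · exact abs_apply_zero_le x
            · exact norm_vecPart_le x
        _ = _ := by ring
    have h3 : 0 ≤ diracProd n p.1 p.2 / p.2.factorial :=
      div_nonneg (diracProd_nonneg _ _ _) (Nat.cast_nonneg _)
    rw [norm_smul, Real.norm_of_nonneg h3]
    calc _ ≤ (((p.1 + p.2).choose p.1 * (n + 1) ^ p.2 : ℝ)) *
          (p.1 * ‖x‖ ^ (k - 1) + p.2 * ‖x‖ ^ (k - 1)) := by
          gcongr
          · exact diracProd_div_factorial_le _ _ _
          · exact (norm_add_le _ _).trans (add_le_add h1 h2)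
      _ = _ := by
          rw [hp]
          have : (k : ℝ) = p.1 + p.2 := by exact_mod_cast hp.symm
          rw [this, nsmul_eq_mul]
          ring
  rw [ckPolyDeriv]
  refine (norm_sum_le_of_le _ hterm).trans (le_of_eq ?_)
  rw [← Finset.mul_sum, ← (Commute.all (1 : ℝ) (n + 1)).add_pow']
  ring_nf

theorem continuous_smulRight {X E F : Type*} [TopologicalSpace X] [NormedAddCommGroup E]
    [NormedSpace ℝ E] [NormedAddCommGroup F] [NormedSpace ℝ F] {f : X → E →L[ℝ] ℝ} {g : X → F}
    (hf : Continuous f) (hg : Continuous g) : Continuous fun x => (f x).smulRight (g x) :=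
  ((ContinuousLinearMap.smulRightL ℝ E F).continuous.comp hf).clm_apply hg

theorem continuous_ckPolyDeriv {n : ℕ} (k : ℕ) : Continuous (ckPolyDeriv (n := n) k) := by
  have h0 (m : ℕ) : Continuous fun x : Paravector n => x 0 ^ m := (scalarPart n).continuous.pow m
  have h1 : Continuous fun x : Paravector n => vecPart x := (vecPartCLM n).continuous
  have h2 (m : ℕ) : Continuous fun x : Paravector n => vec n (vecPart x) ^ m :=
    ((vec n).continuous.comp h1).pow m
  have h3 (m : ℕ) : Continuous fun x : Paravector n => vecPowDeriv m (vecPart x) := by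
    have h4 : Continuous fun x : Paravector n =>
        (innerSL ℝ (vecPart x)).smulRight (vec n (vecPart x) ^ (m - 2)) :=
      continuous_smulRight ((innerSL ℝ).continuous.comp h1) (h2 _)
    have h5 : Continuous fun x : Paravector n =>
        (mulCLM n (vec n (vecPart x) ^ (m - 1))).comp (vec n) :=
      ((mulCLM n).continuous.comp (h2 _)).clm_comp continuous_const
    unfold vecPowDeriv
    split_ifs
    · fun_prop
    · fun_prop
  unfold ckPolyDeriv
  refine continuous_finsetSum _ fun p _ => ?_
  have h4 := (h0 p.2).smul ((h3 p.1).clm_comp (continuous_const (y := vecPartCLM n)))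
  have h5 : Continuous fun x : Paravector n =>
      ((p.2 * x 0 ^ (p.2 - 1)) • scalarPart n).smulRight (vec n (vecPart x) ^ p.1) :=
    continuous_smulRight ((continuous_const.mul (h0 _)).smul continuous_const) (h2 _)
  exact (h4.add h5).const_smul (diracProd n p.1 p.2 / p.2.factorial : ℝ)

/-- The x_0-derivative of the term with exponents (m, j+1) cancels the Dirac derivative of the term
with exponents (m+1, j), by the recursion of the products c_{m+1} ⋯ c_{m+j}. -/
theorem cauchyRiemann_ckPolyDeriv {n : ℕ} (k : ℕ) (x : Paravector n) :
    ckPolyDeriv k x (EuclideanSpace.single 0 1) +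
      ∑ i : Fin n, e i * ckPolyDeriv k x (EuclideanSpace.single i.succ 1) = 0 := by
  have h0 : ckPolyDeriv k x (EuclideanSpace.single 0 1) = ∑ p ∈ antidiagonal k,
      (diracProd n p.1 p.2 / p.2.factorial * (p.2 * x 0 ^ (p.2 - 1))) •
        vec n (vecPart x) ^ p.1 := by
    simp [ckPolyDeriv, smul_smul]
  have h1 : ∑ i : Fin n, e i * ckPolyDeriv k x (EuclideanSpace.single i.succ 1) =
      ∑ p ∈ antidiagonal k, (diracProd n p.1 p.2 / p.2.factorial * x 0 ^ p.2) •
        -diracCoeff n p.1 • vec n (vecPart x) ^ (p.1 - 1) := by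
    simp_rw [← sum_e_mul_vecPowDeriv, Finset.smul_sum]
    rw [Finset.sum_comm]
    refine Finset.sum_congr rfl fun i _ => ?_
    simp [ckPolyDeriv, Finset.mul_sum, smul_smul]
  rw [h0, h1]
  rcases k with _ | k
  · simp
  · rw [Finset.Nat.sum_antidiagonal_succ', Finset.Nat.sum_antidiagonal_succ]
    simp only [Nat.cast_zero, zero_mul, mul_zero, zero_smul, diracCoeff_zero, neg_zero, smul_zero,
      zero_add, ← Finset.sum_add_distrib, smul_smul, ← add_smul, Nat.add_sub_cancel]
    refine Finset.sum_eq_zero fun p _ => ?_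
    have h : diracProd n p.1 (p.2 + 1) / (p.2 + 1).factorial * ((p.2 + 1 : ℕ) * x 0 ^ p.2) +
        diracProd n (p.1 + 1) p.2 / p.2.factorial * x 0 ^ p.2 * -diracCoeff n (p.1 + 1) = 0 := by
      rw [diracProd_succ', Nat.factorial_succ]
      push_cast
      field_simp
      ring
    rw [h, zero_smul]

/-! ### Series in P_k: growth and monogenicity -/

/-- The function `∑ b_k P_k`, where `P_k` is the Cauchy-Kowalewski extension of `v ↦ v^k`. -/
noncomputable def ckSeries {n : ℕ} (b : PowerSeries ℝ) (x : Paravector n) : RealClifford n :=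
  ∑' k, PowerSeries.coeff k b • ckPoly k x

theorem ExpBound.hasSum_ckSeries {n : ℕ} {M ρ : ℝ} {b : PowerSeries ℝ} (hb : ExpBound M ρ b)
    (x : Paravector n) : HasSum (fun k => PowerSeries.coeff k b • ckPoly k x) (ckSeries b x) :=
  (hb.summable_smul (by positivity) fun k => norm_ckPoly_le k x).hasSum

theorem ExpBound.norm_ckSeries_le {n : ℕ} {M ρ : ℝ} {b : PowerSeries ℝ} (hb : ExpBound M ρ b)
    (x : Paravector n) : ‖ckSeries b x‖ ≤ M * Real.exp (ρ * (n * ‖x‖)) :=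
  hb.norm_tsum_smul_le fun k => norm_ckPoly_le k x

theorem ExpBound.hasFDerivAt_ckSeries {n : ℕ} {M ρ : ℝ} {b : PowerSeries ℝ} (hb : ExpBound M ρ b)
    (x : Paravector n) :
    HasFDerivAt (ckSeries b) (∑' k, PowerSeries.coeff k b • ckPolyDeriv k x) x :=
  hb.hasFDerivAt_tsum (by positivity) hasFDerivAt_ckPoly norm_ckPolyDeriv_le
    (hb.hasSum_ckSeries 0).summable x

theorem ExpBound.isLeftMonogenic_ckSeries {n : ℕ} {M ρ : ℝ} {b : PowerSeries ℝ}
    (hb : ExpBound M ρ b) : IsLeftMonogenic (ckSeries (n := n) b) := by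
  constructor
  · exact contDiff_one_iff_hasFDerivAt.2 ⟨_, hb.continuous_tsum_deriv (by positivity)
      norm_ckPolyDeriv_le continuous_ckPolyDeriv, hb.hasFDerivAt_ckSeries⟩
  · intro x
    have hs := (hb.summable_smul_deriv (by positivity) (norm_ckPolyDeriv_le (n := n)) x).hasSum
    have hd (h : Paravector n) := (ContinuousLinearMap.apply ℝ (RealClifford n) h).hasSum hs
    have h1 := (hd (EuclideanSpace.single 0 1)).add (hasSum_sum (s := Finset.univ)
      fun (i : Fin n) _ => (hd (EuclideanSpace.single i.succ 1)).mul_left (e i))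
    simp only [cauchyRiemann, partialDeriv, (hb.hasFDerivAt_ckSeries x).fderiv]
    refine h1.unique (hasSum_zero.congr_fun fun k => ?_)
    simp only [ContinuousLinearMap.apply_apply, smul_apply, mul_smul_comm]
    rw [← Finset.smul_sum, ← smul_add, cauchyRiemann_ckPolyDeriv, smul_zero]

/-! ### Identification with the Cauchy-Kowalewski extension -/

theorem conjCauchyRiemann_pow_smul {n : ℕ} {h : EuclideanSpace ℝ (Fin n) → RealClifford n}
    (hh : Differentiable ℝ h) (m : ℕ) (x : Paravector n) :
    conjCauchyRiemann (fun y => (y 0 ^ (m + 1) / ((m + 1).factorial : ℝ)) • h (vecPart y)) x =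
      (x 0 ^ m / m.factorial) • h (vecPart x) -
        (x 0 ^ (m + 1) / (m + 1).factorial) • dirac h (vecPart x) := by
  have hd : HasFDerivAt
      (fun y : Paravector n => (y 0 ^ (m + 1) / ((m + 1).factorial : ℝ)) • h (vecPart y)) _ x :=
    ((hasFDerivAt_apply_zero_pow (m + 1) x).mul_const _).smul
      ((hh (vecPart x)).hasFDerivAt.comp x (vecPartCLM n).hasFDerivAt)
  have h1 : (((m + 1 : ℕ) : ℝ) * x 0 ^ m) / (m + 1).factorial = x 0 ^ m / m.factorial := by
    rw [Nat.factorial_succ]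
    push_cast
    field_simp
  simp only [conjCauchyRiemann, partialDeriv, dirac, hd.fderiv]
  simp only [add_apply, smul_apply, ContinuousLinearMap.smulRight_apply,
    ContinuousLinearMap.comp_apply, vecPartCLM_apply, vecPart_single_zero, vecPart_single_succ,
    scalarPart_apply, map_zero, smul_zero, zero_add, mul_smul_comm, mul_add, Finset.smul_sum,
    Nat.add_sub_cancel]
  rw [← h1]
  simp [div_eq_mul_inv, mul_comm]

/-- Absolute convergence of the double series over (m, j) permits regrouping it by total degree or
by the power of x_0. The binomial coefficient bounding c_{m+1} ⋯ c_{m+j}/j! splits 1/(m+j)! into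
1/m! · 1/j!, so a product of two exponential series dominates. -/
theorem ExpBound.hasSum_ckSeries_prod {n : ℕ} {M ρ : ℝ} {b : PowerSeries ℝ} (hb : ExpBound M ρ b)
    (x : Paravector n) :
    HasSum (fun p : ℕ × ℕ => PowerSeries.coeff (p.1 + p.2) b •
      (diracProd n p.1 p.2 / p.2.factorial * x 0 ^ p.2) • vec n (vecPart x) ^ p.1)
      (ckSeries b x) := by
  have hρ := hb.1
  have hM := hb.nonneg
  have hsum : Summable (fun p : ℕ × ℕ => PowerSeries.coeff (p.1 + p.2) b •
      (diracProd n p.1 p.2 / p.2.factorial * x 0 ^ p.2) • vec n (vecPart x) ^ p.1) := by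
    have hexp := (Real.summable_pow_div_factorial (ρ * ‖vecPart x‖)).mul_of_nonneg
      (Real.summable_pow_div_factorial (ρ * (n + 1) * |x 0|))
      (fun _ => by positivity) (fun _ => by positivity)
    refine .of_norm_bounded (hexp.mul_left M) fun p => ?_
    have h3 : 0 ≤ diracProd n p.1 p.2 / p.2.factorial :=
      div_nonneg (diracProd_nonneg _ _ _) (Nat.cast_nonneg _)
    rw [norm_smul, norm_smul, norm_mul, Real.norm_of_nonneg h3, norm_vec_pow, norm_pow,
      Real.norm_eq_abs, Real.norm_eq_abs]
    calc |PowerSeries.coeff (p.1 + p.2) b| *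
          (diracProd n p.1 p.2 / p.2.factorial * |x 0| ^ p.2 * ‖vecPart x‖ ^ p.1)
        ≤ (M * (ρ ^ (p.1 + p.2) / (p.1 + p.2).factorial)) *
          (((p.1 + p.2).choose p.1 * (n + 1) ^ p.2) * |x 0| ^ p.2 * ‖vecPart x‖ ^ p.1) := by
          gcongr
          · exact hb.2 _
          · exact diracProd_div_factorial_le _ _ _
      _ = _ := by
          rw [Nat.cast_add_choose, mul_pow, mul_pow, mul_pow, pow_add]
          field_simp
  have hS := hsum.hasSum
  have hk : HasSum (fun k => PowerSeries.coeff k b • ckPoly k x) _ :=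
    (Finset.HasAntidiagonal.sigmaAntidiagonalEquivProd.hasSum_iff.2 hS).sigma fun k => by
      rw [ckPoly, Finset.smul_sum, ← Finset.sum_finset_coe]
      refine (hasSum_fintype _).congr_fun fun p => ?_
      have hp := Finset.HasAntidiagonal.mem_antidiagonal.1 p.2
      simp [hp]
  rwa [hk.unique (hb.hasSum_ckSeries x)] at hS

/-- This is the form exp(-x_0 ∂)f of the extension, obtained by summing over m first; the sign of
(-x_0)^j cancels the (-1)^j from iterating the Dirac operator. -/
theorem ExpBound.hasSum_pow_smul_vecSeries {n : ℕ} {M ρ : ℝ} {b : PowerSeries ℝ}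
    (hb : ExpBound M ρ b) (x : Paravector n) :
    HasSum (fun j => ((-x 0) ^ j / j.factorial) • vecSeries ((Monogenic.diracShift n)^[j] b)
      (vecPart x)) (ckSeries b x) := by
  refine ((Equiv.prodComm ℕ ℕ).hasSum_iff.2 (hb.hasSum_ckSeries_prod x)).prod_fiberwise fun j => ?_
  obtain ⟨M', h⟩ := hb.diracShift_iterate n j
  refine ((h.hasSum_vecSeries (vecPart x)).const_smul _).congr_fun fun m => ?_
  simp only [Function.comp_apply, Equiv.prodComm_apply, Prod.swap, coeff_diracShift_iterate,
    smul_smul]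
  congr 1
  rw [neg_pow (x 0)]
  have : ((-1 : ℝ) ^ j) * (-1) ^ j = 1 := by rw [← mul_pow]; simp
  linear_combination (-(diracProd n m j * PowerSeries.coeff (m + j) b * x 0 ^ j / j.factorial)) * this

theorem summable_even {E : Type*} [NormedAddCommGroup E] [CompleteSpace E] {f : ℕ → E}
    (hf : Summable f) : Summable fun k => f (2 * k) :=
  hf.comp_injective (mul_right_injective₀ (two_ne_zero' ℕ))

theorem summable_odd {E : Type*} [NormedAddCommGroup E] [CompleteSpace E] {f : ℕ → E}
    (hf : Summable f) : Summable fun k => f (2 * k + 1) :=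
  hf.comp_injective ((add_left_injective 1).comp (mul_right_injective₀ (two_ne_zero' ℕ)))

/-- The k-th term of the defining series is the sum of the terms j = 2k and j = 2k + 1 of exp(-x_0
∂)f, since Δ^k = (-1)^k ∂^{2k} and the sign in front squares away. -/
theorem ExpBound.ckExtension_vecSeries {n : ℕ} {M ρ : ℝ} {b : PowerSeries ℝ} (hb : ExpBound M ρ b) :
    ckExtension (vecSeries (n := n) b) = ckSeries b := by
  funext x
  have hj := hb.hasSum_pow_smul_vecSeries x
  set τ : ℕ → RealClifford n := fun j =>
    ((-x 0) ^ j / j.factorial) • vecSeries ((Monogenic.diracShift n)^[j] b) (vecPart x) with hτ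
  have he := summable_even hj.summable
  have ho := summable_odd hj.summable
  rw [← hj.tsum_eq, ← tsum_even_add_odd he ho, ← he.tsum_add ho, ckExtension]
  refine tsum_congr fun k => ?_
  obtain ⟨M', h⟩ := hb.diracShift_iterate n (2 * k)
  have hd : dirac (fun v : EuclideanSpace ℝ (Fin n) =>
      (-1 : ℝ) ^ k • vecSeries ((Monogenic.diracShift n)^[2 * k] b) v) (vecPart x) =
      (-1 : ℝ) ^ k • vecSeries ((Monogenic.diracShift n)^[2 * k + 1] b) (vecPart x) := by
    rw [Function.iterate_succ_apply', ← h.dirac_vecSeries, dirac, dirac,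
      fderiv_fun_const_smul (h.hasFDerivAt_vecSeries _).differentiableAt, Finset.smul_sum]
    exact Finset.sum_congr rfl fun i _ => by rw [smul_apply, mul_smul_comm]
  have hdiff : Differentiable ℝ (fun v : EuclideanSpace ℝ (Fin n) =>
      (-1 : ℝ) ^ k • vecSeries ((Monogenic.diracShift n)^[2 * k] b) v) :=
    fun v => (h.hasFDerivAt_vecSeries v).differentiableAt.fun_const_smul _
  have h1 : ((-1 : ℝ) ^ k) * (-1) ^ k = 1 := by rw [← mul_pow]; simp
  rw [hb.laplacian_iterate_vecSeries, conjCauchyRiemann_pow_smul hdiff, hd, smul_sub, smul_smul,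
    smul_smul, smul_smul, smul_smul, sub_eq_add_neg, ← neg_smul, hτ]
  refine congrArg₂ _ (congrArg (· • _) ?_) (congrArg (· • _) ?_)
  · rw [pow_mul (-x 0), neg_sq, ← pow_mul]
    linear_combination (x 0 ^ (2 * k) / (2 * k).factorial) * h1
  · rw [pow_succ (-x 0), pow_mul (-x 0), neg_sq, ← pow_mul]
    linear_combination (-x 0 ^ (2 * k + 1) / (2 * k + 1).factorial) * h1

/-! ### The CK-product as multiplication of power series -/

theorem ckPoly_ofVec {n : ℕ} (k : ℕ) (v : EuclideanSpace ℝ (Fin n)) :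
    ckPoly k (ofVec v) = vec n v ^ k := by
  rcases k with _ | k
  · simp [ckPoly]
  · rw [ckPoly, Finset.Nat.sum_antidiagonal_succ']
    simp

theorem ckPoly_smul {n : ℕ} (k : ℕ) (c : ℝ) (x : Paravector n) :
    ckPoly k (c • x) = c ^ k • ckPoly k x := by
  have hv : vec n (vecPart (c • x)) = c • vec n (vecPart x) := by
    rw [← map_smul]
    rfl
  rw [ckPoly, ckPoly, Finset.smul_sum]
  refine Finset.sum_congr rfl fun p hp => ?_
  rw [Finset.HasAntidiagonal.mem_antidiagonal] at hp
  rw [hv, smul_pow, smul_smul, smul_smul, ← hp, pow_add, PiLp.smul_apply, smul_eq_mul, mul_pow]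
  congr 1
  ring

theorem ckSeries_ofVec {n : ℕ} (b : PowerSeries ℝ) (v : EuclideanSpace ℝ (Fin n)) :
    ckSeries b (ofVec v) = vecSeries b v := by
  simp_rw [ckSeries, vecSeries, ckPoly_ofVec]

theorem sum_antidiagonal_pow_div_factorial (x y : ℝ) (k : ℕ) :
    ∑ p ∈ antidiagonal k, x ^ p.1 / p.1.factorial * (y ^ p.2 / p.2.factorial) =
      (x + y) ^ k / k.factorial := by
  rw [(Commute.all x y).add_pow', Finset.sum_div]
  refine Finset.sum_congr rfl fun p hp => ?_
  rw [Finset.HasAntidiagonal.mem_antidiagonal] at hp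
  rw [← hp, nsmul_eq_mul, Nat.cast_add_choose]
  field_simp

theorem ExpBound.mul {M M' ρ ρ' : ℝ} {b c : PowerSeries ℝ} (hb : ExpBound M ρ b)
    (hc : ExpBound M' ρ' c) : ExpBound (M * M') (ρ + ρ') (b * c) := by
  refine ⟨add_nonneg hb.1 hc.1, fun k => ?_⟩
  rw [PowerSeries.coeff_mul, ← sum_antidiagonal_pow_div_factorial, Finset.mul_sum]
  refine (Finset.abs_sum_le_sum_abs _ _).trans (Finset.sum_le_sum fun p _ => ?_)
  rw [abs_mul]
  calc |PowerSeries.coeff p.1 b| * |PowerSeries.coeff p.2 c|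
      ≤ (M * (ρ ^ p.1 / p.1.factorial)) * (M' * (ρ' ^ p.2 / p.2.factorial)) :=
        mul_le_mul (hb.2 _) (hc.2 _) (abs_nonneg _) ((abs_nonneg _).trans (hb.2 _))
    _ = _ := by ring

theorem expBound_one : ExpBound 1 0 1 := by
  refine ⟨le_rfl, fun k => ?_⟩
  rcases k with _ | k <;> simp [PowerSeries.coeff_one]

/-- The constant M = 1 is essential: it keeps N-th powers bounded uniformly while the rates add up.
-/
theorem ExpBound.pow {ρ : ℝ} {b : PowerSeries ℝ} (hb : ExpBound 1 ρ b) (N : ℕ) :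
    ExpBound 1 (N * ρ) (b ^ N) := by
  induction N with
  | zero => simpa using expBound_one
  | succ N ih =>
    have h := ih.mul hb
    rw [← pow_succ] at h
    convert h using 1
    · ring
    · push_cast
      ring

theorem ExpBound.sum {ι : Type*} (s : Finset ι) {M : ι → ℝ} {ρ : ℝ} (hρ : 0 ≤ ρ)
    {b : ι → PowerSeries ℝ} (hb : ∀ i ∈ s, ExpBound (M i) ρ (b i)) :
    ExpBound (∑ i ∈ s, M i) ρ (∑ i ∈ s, b i) := by
  refine ⟨hρ, fun k => ?_⟩
  rw [map_sum, Finset.sum_mul]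
  exact (Finset.abs_sum_le_sum_abs _ _).trans (Finset.sum_le_sum fun i hi => (hb i hi).2 k)

theorem ExpBound.sub {M M' ρ : ℝ} {b c : PowerSeries ℝ} (hb : ExpBound M ρ b)
    (hc : ExpBound M' ρ c) : ExpBound (M + M') ρ (b - c) := by
  refine ⟨hb.1, fun k => ?_⟩
  rw [map_sub, add_mul]
  exact (abs_sub _ _).trans (add_le_add (hb.2 k) (hc.2 k))

theorem ExpBound.vecSeries_mul {n : ℕ} {M M' ρ ρ' : ℝ} {b c : PowerSeries ℝ}
    (hb : ExpBound M ρ b) (hc : ExpBound M' ρ' c) (v : EuclideanSpace ℝ (Fin n)) :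
    vecSeries b v * vecSeries c v = vecSeries (b * c) v := by
  have hmul (p : ℕ × ℕ) : (PowerSeries.coeff p.1 b • vec n v ^ p.1) *
      (PowerSeries.coeff p.2 c • vec n v ^ p.2) =
      (PowerSeries.coeff p.1 b * PowerSeries.coeff p.2 c) • vec n v ^ (p.1 + p.2) := by
    rw [smul_mul_smul_comm, ← pow_add]
  have hbc : Summable fun p : ℕ × ℕ => (PowerSeries.coeff p.1 b • vec n v ^ p.1) *
      (PowerSeries.coeff p.2 c • vec n v ^ p.2) := by
    refine .of_norm_bounded ((hb.summable_mul_pow (norm_nonneg v)).mul_of_nonneg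
      (hc.summable_mul_pow (norm_nonneg v)) (fun _ => by positivity) fun _ => by positivity)
      fun p => ?_
    rw [hmul, norm_smul, norm_vec_pow, norm_mul, Real.norm_eq_abs, Real.norm_eq_abs, pow_add]
    exact le_of_eq (by ring)
  rw [vecSeries, vecSeries, (hb.hasSum_vecSeries v).summable.tsum_mul_tsum_eq_tsum_sum_antidiagonal
    (hc.hasSum_vecSeries v).summable hbc, vecSeries]
  refine tsum_congr fun k => ?_
  rw [PowerSeries.coeff_mul, Finset.sum_smul]
  refine Finset.sum_congr rfl fun p hp => ?_
  rw [hmul, Finset.HasAntidiagonal.mem_antidiagonal.1 hp]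

theorem ExpBound.ckProd_ckSeries {n : ℕ} {M M' ρ ρ' : ℝ} {b c : PowerSeries ℝ}
    (hb : ExpBound M ρ b) (hc : ExpBound M' ρ' c) :
    ckProd (ckSeries (n := n) b) (ckSeries c) = ckSeries (b * c) := by
  rw [← (hb.mul hc).ckExtension_vecSeries, ckProd]
  congr 1
  funext v
  rw [ckSeries_ofVec, ckSeries_ofVec, hb.vecSeries_mul hc]

theorem ckSeries_X_pow {n : ℕ} (k : ℕ) (x : Paravector n) :
    ckSeries (PowerSeries.X ^ k) x = ckPoly k x := by
  rw [ckSeries, tsum_eq_single k fun j hj => by simp [PowerSeries.coeff_X_pow, hj]]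
  simp

theorem ExpBound.ckPow_ckSeries {n : ℕ} {ρ : ℝ} {b : PowerSeries ℝ} (hb : ExpBound 1 ρ b)
    (N : ℕ) : ckPow (ckSeries (n := n) b) N = ckSeries (b ^ N) := by
  induction N with
  | zero =>
    funext x
    rw [pow_zero, ← pow_zero PowerSeries.X, ckSeries_X_pow]
    simp [ckPow, ckPoly]
  | succ N ih => rw [ckPow, ih, (hb.pow N).ckProd_ckSeries hb, pow_succ]

/-! ### The power series of E, Cosh, Sinh and F_N -/

theorem zetaVar_eq_ckSeries (n : ℕ) : zetaVar (n := n) = ckSeries PowerSeries.X := by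
  funext x
  rw [← pow_one PowerSeries.X, ckSeries_X_pow]
  have h1 : ∑ _i : Fin n, (x 0 • (1 : RealClifford n)) = (n * x 0) • 1 := by
    simp [← Nat.cast_smul_eq_nsmul ℝ, smul_smul]
  have h2 : diracProd n 0 1 = n := by
    simpa [diracProd] using diracCoeff_two_mul_add_one n 0
  simp_rw [zetaVar, fueterVar, sub_mul, smul_mul_assoc, e_mul_self, smul_neg, sub_neg_eq_add]
  rw [Finset.sum_add_distrib, h1, ckPoly]
  simp [Finset.Nat.antidiagonal_succ, h2, vec_eq_sum, vecPart, ← Algebra.smul_def, add_comm]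

theorem expBound_X : ExpBound 1 1 PowerSeries.X := by
  refine ⟨zero_le_one, fun k => ?_⟩
  rw [PowerSeries.coeff_X]
  split_ifs with h
  · simp [h]
  · simp

theorem ckPow_zetaVar {n : ℕ} (k : ℕ) (x : Paravector n) : ckPow zetaVar k x = ckPoly k x := by
  rw [zetaVar_eq_ckSeries, expBound_X.ckPow_ckSeries, ckSeries_X_pow]

/-- The power series `exp(c t)`. -/
noncomputable def expSeries (c : ℝ) : PowerSeries ℝ := PowerSeries.rescale c (PowerSeries.exp ℝ)

@[simp] theorem coeff_expSeries (c : ℝ) (k : ℕ) :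
    PowerSeries.coeff k (expSeries c) = c ^ k / k.factorial := by
  simp [expSeries, PowerSeries.coeff_rescale, PowerSeries.coeff_exp, div_eq_mul_inv]

theorem expSeries_mul (c d : ℝ) : expSeries c * expSeries d = expSeries (c + d) :=
  PowerSeries.exp_mul_exp_eq_exp_add c d

theorem expSeries_pow (c : ℝ) (k : ℕ) : expSeries c ^ k = expSeries (k * c) := by
  induction k with
  | zero =>
    ext j
    rcases j with _ | j <;> simp [PowerSeries.coeff_one]
  | succ k ih =>
    rw [pow_succ, ih, expSeries_mul]
    congr 1
    push_cast
    ring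

theorem expBound_expSeries {c ρ : ℝ} (h : |c| ≤ ρ) : ExpBound 1 ρ (expSeries c) := by
  refine ⟨(abs_nonneg c).trans h, fun k => ?_⟩
  rw [coeff_expSeries, abs_div, abs_pow, Nat.abs_cast, one_mul]
  gcongr

theorem expE_smul {n : ℕ} (c : ℝ) (x : Paravector n) : expE (c • x) = ckSeries (expSeries c) x := by
  rw [expE, ckSeries]
  refine tsum_congr fun k => ?_
  rw [ckPow_zetaVar, ckPoly_smul, smul_smul, coeff_expSeries, div_eq_inv_mul]

/-- The power series `cosh(s t) + a sinh(s t)`. -/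
noncomputable def coshSinhSeries (s a : ℝ) : PowerSeries ℝ :=
  ((1 + a) / 2) • expSeries s + ((1 - a) / 2) • expSeries (-s)

theorem coeff_coshSinhSeries_two_mul (s a : ℝ) (k : ℕ) :
    PowerSeries.coeff (2 * k) (coshSinhSeries s a) = s ^ (2 * k) / (2 * k).factorial := by
  simp [coshSinhSeries, pow_mul]
  ring

theorem coeff_coshSinhSeries_two_mul_add_one (s a : ℝ) (k : ℕ) :
    PowerSeries.coeff (2 * k + 1) (coshSinhSeries s a) =
      a * (s ^ (2 * k + 1) / (2 * k + 1).factorial) := by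
  simp [coshSinhSeries, pow_mul, pow_succ]
  ring

/-- The factor 1 in even degree and |a| in odd degree are both at most α^k, the latter because an
odd k is at least 1. Moving α into the rate keeps the constant equal to 1. -/
theorem expBound_coshSinhSeries {s : ℝ} (hs : 0 ≤ s) (a : ℝ) :
    ExpBound 1 (max 1 |a| * s) (coshSinhSeries s a) := by
  refine ⟨by positivity, fun k => ?_⟩
  have h1 : 1 ≤ max 1 |a| := le_max_left _ _
  rw [one_mul, mul_pow]
  obtain ⟨m, rfl | rfl⟩ := k.even_or_odd'
  · rw [coeff_coshSinhSeries_two_mul, abs_of_nonneg (by positivity)]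
    gcongr
    exact le_mul_of_one_le_left (by positivity) (one_le_pow₀ h1)
  · rw [coeff_coshSinhSeries_two_mul_add_one, abs_mul,
      abs_of_nonneg (by positivity : 0 ≤ s ^ (2 * m + 1) / _), mul_div_assoc]
    gcongr
    exact (le_max_right _ _).trans (le_self_pow₀ h1 (by omega))

theorem tsum_even_add_tsum_odd {E : Type*} [NormedAddCommGroup E] [CompleteSpace E] {f : ℕ → E}
    {s : E} (hf : HasSum f s) : ∑' k, f (2 * k) + ∑' k, f (2 * k + 1) = s := by
  rw [tsum_even_add_odd (summable_even hf.summable) (summable_odd hf.summable), hf.tsum_eq]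

theorem coshE_add_sinhE {n : ℕ} {s : ℝ} (hs : 0 ≤ s) (a : ℝ) (x : Paravector n) :
    coshE (s • x) + a • sinhE (s • x) = ckSeries (coshSinhSeries s a) x := by
  have hq := (expBound_coshSinhSeries hs a).hasSum_ckSeries x
  have hc : coshE (s • x) = ∑' k : ℕ,
      PowerSeries.coeff (2 * k) (coshSinhSeries s a) • ckPoly (2 * k) x := by
    refine tsum_congr fun k => ?_
    rw [ckPow_zetaVar, ckPoly_smul, smul_smul, coeff_coshSinhSeries_two_mul, div_eq_inv_mul]
  have hs : a • sinhE (s • x) = ∑' k : ℕ,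
      PowerSeries.coeff (2 * k + 1) (coshSinhSeries s a) • ckPoly (2 * k + 1) x := by
    rw [sinhE, ← tsum_const_smul'']
    refine tsum_congr fun k => ?_
    rw [ckPow_zetaVar, ckPoly_smul, smul_smul, smul_smul, coeff_coshSinhSeries_two_mul_add_one,
      div_eq_inv_mul, mul_assoc]
  rw [hc, hs]
  exact tsum_even_add_tsum_odd hq

theorem prototypeF_eq_ckSeries {n : ℕ} (N : ℕ) (a : ℝ) :
    prototypeF (n := n) N a = ckSeries (coshSinhSeries (N : ℝ)⁻¹ a ^ N) := by
  have hN : (0 : ℝ) ≤ (N : ℝ)⁻¹ := by positivity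
  rw [← (expBound_coshSinhSeries hN a).ckPow_ckSeries, prototypeF]
  congr 1
  funext x
  exact coshE_add_sinhE hN a x

theorem coshSinhSeries_pow {N : ℕ} (hN : 1 ≤ N) (a : ℝ) :
    coshSinhSeries (N : ℝ)⁻¹ a ^ N =
      ∑ j ∈ Finset.range (N + 1), coeffC j N a • expSeries (1 - 2 * (j : ℝ) / N) := by
  -- The summands are swapped so that `j` counts the factors exp(-t/N).
  rw [coshSinhSeries, add_comm, add_pow]
  refine Finset.sum_congr rfl fun j hj => ?_
  have hjN : j ≤ N := Nat.lt_succ_iff.1 (Finset.mem_range.1 hj)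
  have hN0 : (N : ℝ) ≠ 0 := by positivity
  have hexp : expSeries (1 - 2 * (j : ℝ) / N) =
      expSeries (-(N : ℝ)⁻¹) ^ j * expSeries (N : ℝ)⁻¹ ^ (N - j) := by
    rw [expSeries_pow, expSeries_pow, expSeries_mul, Nat.cast_sub hjN]
    congr 1
    field_simp
    ring
  rw [smul_pow, smul_pow, smul_mul_smul_comm, ← hexp, mul_comm, ← nsmul_eq_mul,
    ← Nat.cast_smul_eq_nsmul ℝ, smul_smul, coeffC]
  congr 1
  ring

/-! ### Weighted norms and the rate of convergence -/

theorem ExpBound.norm_ckSeries_mul_exp_le {n : ℕ} {M ρ σ : ℝ} {b : PowerSeries ℝ}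
    (hb : ExpBound M ρ b) (hσ : ρ * n ≤ σ) (x : Paravector n) :
    ‖ckSeries b x‖ * Real.exp (-σ * ‖x‖) ≤ M := by
  have hM := hb.nonneg
  calc ‖ckSeries b x‖ * Real.exp (-σ * ‖x‖)
      ≤ M * Real.exp (ρ * (n * ‖x‖)) * Real.exp (-σ * ‖x‖) := by
        gcongr
        exact hb.norm_ckSeries_le x
    _ = M * Real.exp ((ρ * n - σ) * ‖x‖) := by
        rw [mul_assoc, ← Real.exp_add]
        congr 2
        ring
    _ ≤ M * 1 := by
        gcongr
        exact Real.exp_le_one_iff.2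
          (mul_nonpos_of_nonpos_of_nonneg (by linarith) (norm_nonneg x))
    _ = M := mul_one M

theorem ExpBound.memA_ckSeries {n : ℕ} {M ρ σ : ℝ} {b : PowerSeries ℝ} (hb : ExpBound M ρ b)
    (hσ : ρ * n ≤ σ) : MemA σ (ckSeries (n := n) b) :=
  ⟨hb.isLeftMonogenic_ckSeries, M, Set.forall_mem_range.2 (hb.norm_ckSeries_mul_exp_le hσ)⟩

theorem ExpBound.expNorm_ckSeries_le {n : ℕ} {M ρ σ : ℝ} {b : PowerSeries ℝ}
    (hb : ExpBound M ρ b) (hσ : ρ * n ≤ σ) : expNorm σ (ckSeries (n := n) b) ≤ M :=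
  ciSup_le (hb.norm_ckSeries_mul_exp_le hσ)

theorem expBound_expSeries_mul {s : ℝ} (hs : 0 ≤ s) (a : ℝ) :
    ExpBound 1 (max 1 |a| * s) (expSeries (s * a)) := by
  refine expBound_expSeries ?_
  rw [abs_mul, abs_of_nonneg hs, mul_comm]
  gcongr
  exact le_max_right _ _

/-- The coefficients of degree 0 and 1 agree. From degree 2 on, N^{-k} ≤ N^{-2} is pulled out of the
rate α/N, leaving the rate α and a constant of order N^{-2}. -/
theorem expBound_coshSinhSeries_sub_expSeries {N : ℕ} (hN : 1 ≤ N) (a : ℝ) :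
    ExpBound (2 / (N : ℝ) ^ 2) (max 1 |a|)
      (coshSinhSeries (N : ℝ)⁻¹ a - expSeries ((N : ℝ)⁻¹ * a)) := by
  have hN1 : (1 : ℝ) ≤ N := by exact_mod_cast hN
  have hN0 : (0 : ℝ) < N := by positivity
  have hα : 0 < max 1 |a| := lt_max_of_lt_left one_pos
  have hs : 0 ≤ (N : ℝ)⁻¹ := by positivity
  refine ⟨hα.le, fun k => ?_⟩
  have hq := expBound_coshSinhSeries hs a
  have he := expBound_expSeries_mul hs a
  rcases k with _ | _ | k
  · have := coeff_coshSinhSeries_two_mul (N : ℝ)⁻¹ a 0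
    rw [map_sub, coeff_expSeries, this]
    simp
    positivity
  · have := coeff_coshSinhSeries_two_mul_add_one (N : ℝ)⁻¹ a 0
    rw [map_sub, coeff_expSeries, this]
    simp [mul_comm a]
    positivity
  · refine ((hq.sub he).2 (k + 2)).trans ?_
    have h2 : ((N : ℝ)⁻¹) ^ (k + 2) ≤ ((N : ℝ) ^ 2)⁻¹ := by
      rw [← inv_pow]
      exact pow_le_pow_of_le_one hs (inv_le_one_of_one_le₀ hN1) (Nat.le_add_left 2 k)
    calc (1 + 1) * ((max 1 |a| * (N : ℝ)⁻¹) ^ (k + 2) / (k + 2).factorial)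
        = 2 * (max 1 |a| ^ (k + 2) / (k + 2).factorial) * ((N : ℝ)⁻¹) ^ (k + 2) := by
          rw [mul_pow]
          ring
      _ ≤ 2 * (max 1 |a| ^ (k + 2) / (k + 2).factorial) * ((N : ℝ) ^ 2)⁻¹ := by gcongr
      _ = _ := by ring

theorem expBound_coshSinhSeries_pow {N : ℕ} (hN : 1 ≤ N) (a : ℝ) :
    ExpBound 1 (max 1 |a|) (coshSinhSeries (N : ℝ)⁻¹ a ^ N) := by
  have hN0 : (N : ℝ) ≠ 0 := by positivity
  refine ((expBound_coshSinhSeries (by positivity) a).pow N).mono le_rfl (le_of_eq ?_)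
  field_simp

/-- In q^N - p^N = (∑ q^i p^{N-1-i})(q - p) the sum has N terms, each majorized by exp(αt), and q -
p contributes (2/N²) exp(αt). The two rates add to 2α. -/
theorem expBound_coshSinhSeries_pow_sub {N : ℕ} (hN : 1 ≤ N) (a : ℝ) :
    ExpBound (2 / N) (2 * max 1 |a|) (coshSinhSeries (N : ℝ)⁻¹ a ^ N - expSeries a) := by
  have hN0 : (N : ℝ) ≠ 0 := by positivity
  have hs : 0 ≤ (N : ℝ)⁻¹ := by positivity
  have hα : 0 < max 1 |a| := lt_max_of_lt_left one_pos
  have hq := expBound_coshSinhSeries hs a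
  have he := expBound_expSeries_mul hs a
  have hsum : ExpBound (∑ _i ∈ Finset.range N, (1 * 1 : ℝ)) (max 1 |a|)
      (∑ i ∈ Finset.range N, coshSinhSeries (N : ℝ)⁻¹ a ^ i *
        expSeries ((N : ℝ)⁻¹ * a) ^ (N - 1 - i)) := by
    refine ExpBound.sum _ hα.le fun i hi => ((hq.pow i).mul (he.pow (N - 1 - i))).mono le_rfl ?_
    have hi' : (i : ℝ) + (N - 1 - i : ℕ) ≤ N := by
      have := Finset.mem_range.1 hi
      exact_mod_cast (by omega : i + (N - 1 - i) ≤ N)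
    calc i * (max 1 |a| * (N : ℝ)⁻¹) + (N - 1 - i : ℕ) * (max 1 |a| * (N : ℝ)⁻¹)
        = (i + (N - 1 - i : ℕ)) * (max 1 |a| * (N : ℝ)⁻¹) := by ring
      _ ≤ N * (max 1 |a| * (N : ℝ)⁻¹) := by gcongr
      _ = max 1 |a| := by field_simp
  have hexp : expSeries a = expSeries ((N : ℝ)⁻¹ * a) ^ N := by
    rw [expSeries_pow, mul_inv_cancel_left₀ hN0]
  have h := hsum.mul (expBound_coshSinhSeries_sub_expSeries hN a)
  rw [(Commute.all _ _).geom_sum₂_mul, ← hexp] at h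
  refine h.mono (le_of_eq ?_) (le_of_eq (by ring))
  simp
  field_simp

end Monogenic

theorem mainTheorem6 (n : ℕ) (a : ℝ) :
    (∀ N : ℕ, 1 ≤ N → ∀ x : Monogenic.Paravector n,
      Monogenic.prototypeF N a x =
        ∑ j ∈ Finset.range (N + 1),
          Monogenic.coeffC j N a • Monogenic.expE ((1 - 2 * (j : ℝ) / (N : ℝ)) • x)) ∧
    (∀ N : ℕ, 1 ≤ N → ∀ x : Monogenic.Paravector n,
      ‖Monogenic.prototypeF N a x‖ ≤ Real.exp ((max 1 |a| + 1) * (n : ℝ) * ‖x‖)) ∧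
    Monogenic.ConvergesInA
      (fun N : ℕ => Monogenic.prototypeF (n := n) (N + 1) a)
      (fun x => Monogenic.expE (a • x)) := by
  have hα : 0 < max 1 |a| := lt_max_of_lt_left one_pos
  -- The difference F_N - E(a·) has rate 2α, whence σ ≥ 2αn; the extra 1 keeps σ positive when n =
  -- 0.
  refine ⟨fun N hN x => ?_, fun N hN x => ?_, 2 * max 1 |a| * n + 1, by positivity, ?_,
    fun N => ?_, ?_⟩
  · rw [Monogenic.prototypeF_eq_ckSeries]
    simp_rw [Monogenic.expE_smul]
    have h := hasSum_sum (s := Finset.range (N + 1)) fun j _ =>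
      ((Monogenic.expBound_expSeries (le_refl |1 - 2 * (j : ℝ) / (N : ℝ)|)).hasSum_ckSeries
        x).const_smul (Monogenic.coeffC j N a)
    refine ((Monogenic.expBound_coshSinhSeries_pow hN a).hasSum_ckSeries x).unique
      (h.congr_fun fun k => ?_)
    rw [Monogenic.coshSinhSeries_pow hN, map_sum, Finset.sum_smul]
    simp [smul_smul]
  · rw [Monogenic.prototypeF_eq_ckSeries]
    -- This gives the stronger bound exp(αn|x|), which is then relaxed to α + 1.
    refine ((Monogenic.expBound_coshSinhSeries_pow hN a).norm_ckSeries_le x).trans ?_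
    rw [one_mul, ← mul_assoc]
    gcongr
    linarith
  · simp_rw [Monogenic.expE_smul]
    refine (Monogenic.expBound_expSeries (le_max_right 1 |a|)).memA_ckSeries ?_
    have : 0 ≤ max 1 |a| * n := by positivity
    linarith
  · beta_reduce
    rw [Monogenic.prototypeF_eq_ckSeries]
    refine (Monogenic.expBound_coshSinhSeries_pow (Nat.le_add_left 1 N) a).memA_ckSeries ?_
    have : 0 ≤ max 1 |a| * n := by positivity
    linarith
  · have hd (N : ℕ) : (Monogenic.prototypeF (n := n) (N + 1) a - fun x => Monogenic.expE (a • x)) =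
        Monogenic.ckSeries (Monogenic.coshSinhSeries ((N + 1 : ℕ) : ℝ)⁻¹ a ^ (N + 1) -
          Monogenic.expSeries a) := by
      funext x
      have hN : 1 ≤ N + 1 := Nat.le_add_left 1 N
      rw [Pi.sub_apply, Monogenic.prototypeF_eq_ckSeries, Monogenic.expE_smul]
      have h := ((Monogenic.expBound_coshSinhSeries_pow hN a).hasSum_ckSeries x).sub
        ((Monogenic.expBound_expSeries (le_refl |a|)).hasSum_ckSeries x)
      refine h.unique (((Monogenic.expBound_coshSinhSeries_pow_sub hN a).hasSum_ckSeries
        x).congr_fun fun k => ?_)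
      rw [map_sub, sub_smul]
    simp_rw [hd]
    have hlim : Filter.Tendsto (fun N : ℕ => (2 : ℝ) / (N + 1 : ℕ)) Filter.atTop (nhds 0) :=
      (tendsto_const_div_atTop_nhds_zero_nat 2).comp (Filter.tendsto_add_atTop_nat 1)
    refine squeeze_zero (fun N => Real.iSup_nonneg fun x => by positivity) (fun N => ?_) hlim
    exact (Monogenic.expBound_coshSinhSeries_pow_sub (Nat.le_add_left 1 N) a).expNorm_ckSeries_le
      (by linarith)
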